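/- **Model.** Time is slotted. A primary user (PU) sends packets to a destination $D_p$, and $N\ge 2$ backlogged secondary users (SUs) $s_1,\dots,s_N$ send packets of their own to a destination $D_s$ and may relay PU packets. In each slot a packet arrives at the PU with probability $\lambda_p\in[0,1)$. The channel gains of the links $p\to D_p$, $p\to s_i$, $s_i\to D_p$, $s_i\to D_s$ are exponential, the first with mean $\sigma_p^2>0$ and all the others with one common mean $\sigma^2>0$. Arrivals and gains are all mutually independent, and independent and identically distributed over slots. A link of gain $h$ used with power $P$ against interference power $I$ is successful if $\log_2\bigl(1+\frac{Ph}{N_0+I}\bigr)\ge R_0$, where $R_0>0$ is the target rate and $N_0>0$ the noise variance. If the PU queue $Q_p$ is non-empty, the PU transmits its head packet with power $P_0>0$ (without interference). The packet leaves $Q_p$ if $D_p$ or at least one SU decodes it, and it joins the common relay queue $Q_r$ if $D_p$ fails and at least one SU decodes it. If $Q_p$ is empty (the PU is idle) and $Q_r$ is empty, the SU $s^*$ with the best link to $D_s$ sends a packet of its own. If $Q_p$ is empty and $Q_r$ is not, then one SU $r^*$ relays a packet of $Q_r$ to $D_p$ while another SU $s^*$ sends a packet of its own to $D_s$; the transmission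 of $s^*$ interferes with that of $r^*$ at $D_p$, but not conversely. Successfully transmitted packets leave their queues. Queue lengths evolve by $Q[n+1]=(Q[n]-L[n])^++A[n]$, with $L[n]$, $A[n]$ the departures and arrivals in slot $n$, from an arbitrary deterministic initial state. *Node selection:* either $s^*$ has the best link to $D_s$ among all SUs and $r^*$ the best link to $D_p$ among the others (BSL), or $r^*$ has the best link to $D_p$ among all SUs and $s^*$ the best link to $D_s$ among the others (BPL). *Power allocation:* either every transmitting SU uses power $P_{\max}>0$ (equal power), or (adaptive power) each uses the least power that makes its transmission successful, computed first for $s^*$ and then for $r^*$ given the interference from $s^*$. In the latter case, if this power exceeds $P_{\max}$ for one of them, that SU is silent, and the other one, if still able to transmit, is replaced by the SU with the best link to the destination in question and transmits alone. Let $f_p$ be the probability that $D_p$ decodes a PU transmission, $f_{ps}$ the probability that at least one SU decodes it, and $f_{r^*}$ the probability that a packet is successfully relayed in a slot with $Q_p$ empty and $Q_r$ non-empty. Let $f_{s^*}$ be the limit, as $n\to\infty$, of the conditional probability that the transmission of $s^*$ in slot $n$ is successful given that the PU is idle in slot $n$. Put $\mu_p=f_p+(1-f_p)f_{ps}$. A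 queue is stable if its length converges in distribution to a finite random variable, and the system is stable if $Q_p$ and $Q_r$ both are. The throughput of the PU, respectively of an SU, is the almost sure long-run number per slot of PU packets delivered to $D_p$, respectively of packets of that SU delivered to $D_s$. **Theorem 1.** For each of the four combinations of power allocation and node selection policies: 1. The system is stable if and only if $$\lambda_p<\frac{f_{r^*}[f_p+(1-f_p)f_{ps}]}{f_{r^*}+(1-f_p)f_{ps}}.\qquad(*)$$ 2. The maximum achievable PU throughput, that is, the supremum of the PU throughputs over all $\lambda_p\in[0,1)$ for which the system is stable, is the right-hand side of $(*)$. 3. If $(*)$ holds, then the PU has throughput $\lambda_p$, the limit $f_{s^*}$ exists, and each SU $s_i$ has throughput $$\mu_{s_i}=\frac1N\left[1-\frac{\lambda_p}{\mu_p}\right]f_{s^*}.$$ Moreover $f_{s^*}=\gamma f^{\mathrm B}+(1-\gamma)f^{\mathrm E}$ with $\gamma=\frac{\lambda_p(1-f_p)f_{ps}}{(\mu_p-\lambda_p)f_{r^*}}$, where $f^{\mathrm B}$ and $f^{\mathrm E}$ are the success probabilities of the transmission of $s^*$ in a slot with $Q_p$ empty and with $Q_r$ non-empty, respectively empty. -/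

import Mathlib

open MeasureTheory ProbabilityTheory Filter Topology

noncomputable section

namespace CognitiveRelay

/-- How the secondary users (SUs) choose their transmit powers. -/
inductive PowerPolicy
  | equal
  | adaptive

/-- How the two transmitting SUs are chosen: best secondary link or best primary link first. -/
inductive SelectionPolicy
  | bestSecondary
  | bestPrimary

/-- The physical parameters of the network, together with the two policies in force. -/
structure Network where
  /-- number of SUs -/
  N : ℕ
  two_le_N : 2 ≤ N
  /-- target transmission rate, in bits per channel use -/
  R₀ : ℝ
  R₀_pos : 0 < R₀
  /-- transmit power of the primary user (PU) -/
  P₀ : ℝ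
  P₀_pos : 0 < P₀
  /-- maximal transmit power of an SU -/
  Pmax : ℝ
  Pmax_pos : 0 < Pmax
  /-- noise variance -/
  N₀ : ℝ
  N₀_pos : 0 < N₀
  /-- mean channel gain of the link from the PU to its destination -/
  σp2 : ℝ
  σp2_pos : 0 < σp2
  /-- mean channel gain of all the other links -/
  σ2 : ℝ
  σ2_pos : 0 < σ2
  power : PowerPolicy
  selection : SelectionPolicy

/-- The randomness of one time slot: the arrival at the PU, and the channel gains (absolute
squared fading coefficients) PU → primary destination, PU → SUs, SUs → primary destination,
SUs → secondary destination. -/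
abbrev Slot (N : ℕ) : Type :=
  Bool × ℝ × (Fin N → ℝ) × (Fin N → ℝ) × (Fin N → ℝ)

namespace Slot

variable {N : ℕ}

/-- a packet arrives at the PU in this slot -/
def arrival (x : Slot N) : Bool := x.1
/-- gain of PU → primary destination -/
def hp (x : Slot N) : ℝ := x.2.1
/-- gains of PU → SU -/
def hps (x : Slot N) : Fin N → ℝ := x.2.2.1
/-- gains of SU → primary destination -/
def hr (x : Slot N) : Fin N → ℝ := x.2.2.2.1
/-- gains of SU → secondary destination -/
def hs (x : Slot N) : Fin N → ℝ := x.2.2.2.2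

end Slot

/-- The member of `S` with the largest gain (the one with the least index, should there be a tie,
which has probability zero in the model). -/
def bestLink {N : ℕ} (S : Finset (Fin N)) (hS : S.Nonempty) (h : Fin N → ℝ) : Fin N :=
  (S.filter (fun i => ∀ j ∈ S, h j ≤ h i)).min' (by
    obtain ⟨i, hi, hmax⟩ := S.exists_max_image h hS
    exact ⟨i, Finset.mem_filter.2 ⟨hi, hmax⟩⟩)

/-- Who transmits, and with which power, in a slot where the PU is idle. `s` sends a packet of its
own to the secondary destination with power `Ps`, and `r` relays a PU packet to the primary
destination with power `Pr`. Power zero means silence. -/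
structure Allocation (N : ℕ) where
  s : Fin N
  r : Fin N
  Ps : ℝ
  Pr : ℝ

namespace Network

variable (G : Network)

/-- Joint law of the arrival (Bernoulli with parameter `lam`) and the channel gains (exponential)
in one slot, all independent. -/
def slotLaw (lam : unitInterval) : Measure (Slot G.N) :=
  (bernoulliMeasure true false lam).prod <|
    (expMeasure (1 / G.σp2)).prod <|
      (Measure.pi fun _ => expMeasure (1 / G.σ2)).prod <|
        (Measure.pi fun _ => expMeasure (1 / G.σ2)).prod <|
          Measure.pi fun _ => expMeasure (1 / G.σ2)

/-- Law of the whole sequence of slots: they are independent and identically distributed. -/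
def law (lam : unitInterval) : Measure (ℕ → Slot G.N) :=
  Measure.infinitePi fun _ => G.slotLaw lam

/-- A link of gain `h`, used with power `P` against interference power `I`, supports the target
rate (no outage). -/
def Supports (P h I : ℝ) : Prop :=
  G.R₀ ≤ Real.logb 2 (1 + P * h / (G.N₀ + I))

/-- The least power with which a link of gain `h` supports the target rate against interference
power `I`. -/
def minPower (h I : ℝ) : ℝ :=
  ((2 : ℝ) ^ G.R₀ - 1) * (G.N₀ + I) / h

lemma univ_nonempty : (Finset.univ : Finset (Fin G.N)).Nonempty :=
  ⟨⟨0, lt_of_lt_of_le two_pos G.two_le_N⟩, Finset.mem_univ _⟩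

lemma erase_nonempty (i : Fin G.N) : (Finset.univ.erase i).Nonempty := by
  rw [← Finset.card_pos, Finset.card_erase_of_mem (Finset.mem_univ _), Finset.card_univ,
    Fintype.card_fin]
  have := G.two_le_N
  omega

/-- The SU with the best link among all SUs. -/
def best (h : Fin G.N → ℝ) : Fin G.N := bestLink Finset.univ G.univ_nonempty h

/-- The SU with the best link among all SUs but `i`. -/
def bestExcept (i : Fin G.N) (h : Fin G.N → ℝ) : Fin G.N :=
  bestLink (Finset.univ.erase i) (G.erase_nonempty i) h

/-- The pair `(s, r)` singled out by the selection policy for a simultaneous transmission. -/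
def selectPair (x : Slot G.N) : Fin G.N × Fin G.N :=
  match G.selection with
  | .bestSecondary => (G.best x.hs, G.bestExcept (G.best x.hs) x.hr)
  | .bestPrimary => (G.bestExcept (G.best x.hr) x.hs, G.best x.hr)

/-- The power of an SU that transmits alone over a link of gain `h`. -/
def alonePower (h : ℝ) : ℝ :=
  match G.power with
  | .equal => G.Pmax
  | .adaptive => if G.minPower h 0 ≤ G.Pmax then G.minPower h 0 else 0

/-- PU idle and relay queue empty: the SU with the best link to the secondary destination
transmits a packet of its own, and nothing is relayed. -/
def aloneAllocation (x : Slot G.N) : Allocation G.N where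
  s := G.best x.hs
  r := G.best x.hr
  Ps := G.alonePower (x.hs (G.best x.hs))
  Pr := 0

/-- PU idle and relay queue nonempty. With equal power both selected SUs use `Pmax`. With adaptive
power each uses the least sufficient power, first `s` and then `r` given the interference from `s`;
an SU for which `Pmax` does not suffice is silenced, and the other one, if it is still able to
transmit, is then replaced by the SU with the best link to the destination in question. -/
def jointAllocation (x : Slot G.N) : Allocation G.N :=
  let s := (G.selectPair x).1
  let r := (G.selectPair x).2
  match G.power with
  | .equal => ⟨s, r, G.Pmax, G.Pmax⟩
  | .adaptive =>
    let Ps := G.minPower (x.hs s) 0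
    let Pr := G.minPower (x.hr r) (Ps * x.hr s)
    if Ps ≤ G.Pmax then
      if Pr ≤ G.Pmax then ⟨s, r, Ps, Pr⟩
      else ⟨G.best x.hs, r, G.alonePower (x.hs (G.best x.hs)), 0⟩
    else ⟨s, G.best x.hr, 0, G.alonePower (x.hr (G.best x.hr))⟩

/-- The secondary link is free of interference, thanks to dirty-paper coding. -/
def SecondaryOK (a : Allocation G.N) (x : Slot G.N) : Prop :=
  G.Supports a.Ps (x.hs a.s) 0

/-- The relay link suffers the interference caused by `s` at the primary destination. -/
def RelayOK (a : Allocation G.N) (x : Slot G.N) : Prop :=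
  G.Supports a.Pr (x.hr a.r) (a.Ps * x.hr a.s)

/-- The primary destination decodes a packet sent by the PU. -/
def DirectOK (x : Slot G.N) : Prop := G.Supports G.P₀ x.hp 0

/-- At least one SU decodes a packet sent by the PU. -/
def OverheardOK (x : Slot G.N) : Prop := ∃ i, G.Supports G.P₀ (x.hps i) 0

/-! The arrival rate plays no role in the following probabilities: they involve channel gains
only. It is set to zero in them. -/

/-- success probability of PU → primary destination -/
def fp : ℝ := (G.slotLaw 0).real {x | G.DirectOK x}

/-- probability that at least one SU decodes a PU packet -/
def fps : ℝ := (G.slotLaw 0).real {x | G.OverheardOK x}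

/-- success probability of the relay link -/
def fr : ℝ := (G.slotLaw 0).real {x | G.RelayOK (G.jointAllocation x) x}

/-- success probability of the secondary link when the relay queue is nonempty -/
def fsBusy : ℝ := (G.slotLaw 0).real {x | G.SecondaryOK (G.jointAllocation x) x}

/-- success probability of the secondary link when the relay queue is empty -/
def fsEmpty : ℝ := (G.slotLaw 0).real {x | G.SecondaryOK (G.aloneAllocation x) x}

/-- service rate of the PU queue -/
def μp : ℝ := G.fp + (1 - G.fp) * G.fps

/-- long-run proportion of idle slots in which the relay queue is nonempty -/
def γ (lam : ℝ) : ℝ := lam * (1 - G.fp) * G.fps / ((G.μp - lam) * G.fr)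

/-- The allocation in an idle slot when `qr` packets wait in the relay queue. -/
def allocation (qr : ℕ) (x : Slot G.N) : Allocation G.N :=
  if qr = 0 then G.aloneAllocation x else G.jointAllocation x

open Classical in
/-- One slot of the queue dynamics: `q = (length of the PU queue, length of the relay queue)` at
the beginning of the slot is mapped to the lengths at the beginning of the next one, each being
`(q - departures)⁺ + arrivals`. -/
def step (x : Slot G.N) (q : ℕ × ℕ) : ℕ × ℕ :=
  let Lp := if 0 < q.1 ∧ (G.DirectOK x ∨ G.OverheardOK x) then 1 else 0
  let Ap := if x.arrival = true then 1 else 0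
  let Lr := if q.1 = 0 ∧ 0 < q.2 ∧ G.RelayOK (G.allocation q.2 x) x then 1 else 0
  let Ar := if 0 < q.1 ∧ ¬ G.DirectOK x ∧ G.OverheardOK x then 1 else 0
  (q.1 - Lp + Ap, q.2 - Lr + Ar)

/-- The lengths of the PU queue and of the relay queue at the beginning of slot `n`, starting from
`q₀`. -/
def queue (q₀ : ℕ × ℕ) (ω : ℕ → Slot G.N) : ℕ → ℕ × ℕ
  | 0 => q₀
  | n + 1 => G.step (ω n) (queue q₀ ω n)

/-- In slot `n` a PU packet is delivered to the primary destination, directly or by the relay. -/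
def PrimaryDelivery (q₀ : ℕ × ℕ) (n : ℕ) (ω : ℕ → Slot G.N) : Prop :=
  let q := G.queue q₀ ω n
  (0 < q.1 ∧ G.DirectOK (ω n)) ∨
    (q.1 = 0 ∧ 0 < q.2 ∧ G.RelayOK (G.allocation q.2 (ω n)) (ω n))

/-- In slot `n` the PU is idle. -/
def PUIdle (q₀ : ℕ × ℕ) (n : ℕ) (ω : ℕ → Slot G.N) : Prop :=
  (G.queue q₀ ω n).1 = 0

/-- The secondary link, if used in slot `n`, is successful. -/
def SecondarySuccess (q₀ : ℕ × ℕ) (n : ℕ) (ω : ℕ → Slot G.N) : Prop :=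
  G.SecondaryOK (G.allocation (G.queue q₀ ω n).2 (ω n)) (ω n)

/-- In slot `n` SU `i` delivers a packet of its own to the secondary destination. -/
def SecondaryDelivery (q₀ : ℕ × ℕ) (i : Fin G.N) (n : ℕ) (ω : ℕ → Slot G.N) : Prop :=
  G.PUIdle q₀ n ω ∧ (G.allocation (G.queue q₀ ω n).2 (ω n)).s = i ∧ G.SecondarySuccess q₀ n ω

/-- A queue with (random) length `Q n` at the beginning of slot `n` is stable if its length
converges in distribution to a proper (finite) limit. -/
def QueueStable {Ω : Type*} [MeasurableSpace Ω] (μ : Measure Ω) (Q : ℕ → Ω → ℕ) : Prop :=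
  ∃ F : ℕ → ℝ, (∀ x, Tendsto (fun n => μ.real {ω | Q n ω < x}) atTop (𝓝 (F x))) ∧
    Tendsto F atTop (𝓝 1)

/-- Both queues with stochastic arrivals, the PU queue and the relay queue, are stable. -/
def SystemStable (lam : unitInterval) (q₀ : ℕ × ℕ) : Prop :=
  QueueStable (G.law lam) (fun n ω => (G.queue q₀ ω n).1) ∧
    QueueStable (G.law lam) (fun n ω => (G.queue q₀ ω n).2)

open Classical in
/-- Almost surely, the long-run number per slot of the events `E n` is `τ`. -/
def HasRate (lam : unitInterval) (E : ℕ → (ℕ → Slot G.N) → Prop) (τ : ℝ) : Prop :=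
  ∀ᵐ ω ∂ G.law lam,
    Tendsto (fun n : ℕ => (∑ k ∈ Finset.range n, if E k ω then (1 : ℝ) else 0) / n)
      atTop (𝓝 τ)

/-- The PU has throughput `τ`: packets reach the primary destination at rate `τ`. -/
def PrimaryThroughput (lam : unitInterval) (q₀ : ℕ × ℕ) (τ : ℝ) : Prop :=
  G.HasRate lam (G.PrimaryDelivery q₀) τ

/-- SU `i` has throughput `τ`. -/
def SecondaryThroughput (lam : unitInterval) (q₀ : ℕ × ℕ) (i : Fin G.N) (τ : ℝ) : Prop :=
  G.HasRate lam (G.SecondaryDelivery q₀ i) τ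

/-- `f` is the success probability of the secondary link: the steady-state conditional probability
that the secondary transmission succeeds in a slot, given that the PU is idle in that slot. -/
def IsSecondarySuccessProb (lam : unitInterval) (q₀ : ℕ × ℕ) (f : ℝ) : Prop :=
  Tendsto (fun n => (G.law lam)[|{ω | G.PUIdle q₀ n ω}].real {ω | G.SecondarySuccess q₀ n ω})
    atTop (𝓝 f)

end Network

end CognitiveRelay

end

/-! Write ρ = (1 - fp) fps for the probability that a transmitted PU packet moves to the relay
queue. Slots are i.i.d. and the queue lengths at the start of a slot depend on earlier slots only,
so the pair of queues is a Markov chain on ℕ × ℕ. In a balanced system the PU is busy a fraction lam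
/ μp of the time and the relay queue is served in idle slots only. The stability condition says that
the relay input lam ρ / μp is less than its available service fr (1 - lam / μp), that is, lam (fr +
ρ) < fr μp.

Sufficiency: under this inequality a linear function of the queue lengths has negative drift off the
empty state (`exists_negative_drift`), so an exponential of it is a Lyapunov function
(`exists_lyapunov`). It yields exponential tails uniform in time and a geometric bound on the time
to empty (`exists_exponential_tails`). Limits in distribution come from monotonicity rather than
from ergodic theory: a slot preserves the order of states (`step_mono`), so from the empty state the
probability of a lower set decreases in time, and any other trajectory merges with the empty-started
one as soon as it is empty (`exists_tendsto_law_queue`).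

Necessity: if the inequality fails, fr q₁ + lam q₂ has nonnegative drift everywhere and drift fr lam
at the empty state (`weight_add_sum_le_integral`). Stability implies tightness. Tightness bounds the
probability of the empty state from below (here lam < 1 matters), so the mean of this function grows
linearly; but tightness and bounded increments also make it sublinear. The critical load is covered
as well.

Throughputs: a strong law for past-dependent weights times centred functions of the current slot
(`ae_weighted_average_tendsto_zero`) converts frequencies of queue states into rates of events and
back. Since Q / n → 0, flow balance determines the frequencies (`ae_frequencies`). Exchangeability
of the SUs gives the factor 1 / N, and γ is the share of idle slots in which the relay queue is
nonempty. -/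

noncomputable section

namespace CognitiveRelay

/-! ### Independent slots: past and present, exponential moments, a strong law -/

section IID

variable {S : Type*} [MeasurableSpace S]

/-- The σ-algebra generated by the first `n` coordinates of a sequence. -/
@[reducible] def past (S : Type*) [MeasurableSpace S] (n : ℕ) : MeasurableSpace (ℕ → S) :=
  ⨆ k ∈ Set.Iio n, MeasurableSpace.comap (fun ω : ℕ → S => ω k) inferInstance

lemma past_le (n : ℕ) : past S n ≤ MeasurableSpace.pi :=
  iSup₂_le fun k _ => (measurable_pi_apply k).comap_le

lemma past_mono {m n : ℕ} (h : m ≤ n) : past S m ≤ past S n :=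
  biSup_mono fun _ hk => lt_of_lt_of_le hk h

lemma measurable_past_eval {k n : ℕ} (h : k < n) : Measurable[past S n] (fun ω : ℕ → S => ω k) :=
  measurable_iff_comap_le.2 (le_iSup₂_of_le (f := fun k (_ : k ∈ Set.Iio n) =>
    MeasurableSpace.comap (fun ω : ℕ → S => ω k) inferInstance) k h le_rfl)

variable (ν : Measure S) [IsProbabilityMeasure ν]

lemma indepFun_past {β : Type*} [MeasurableSpace β] {n : ℕ} {Y : (ℕ → S) → β}
    (hY : Measurable[past S n] Y) :
    IndepFun Y (fun ω => ω n) (Measure.infinitePi fun _ => ν) := by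
  have h : iIndepFun (fun (i : ℕ) (ω : ℕ → S) => ω i) (Measure.infinitePi fun _ => ν) :=
    iIndepFun_infinitePi (X := fun _ x => x) (fun _ => measurable_id)
  have h2 := indep_iSup_of_disjoint (fun i => (measurable_pi_apply i).comap_le) h
    (S := Set.Iio n) (T := {n}) (by simp)
  rw [IndepFun_iff_Indep]
  refine indep_of_indep_of_le_left (indep_of_indep_of_le_right h2 ?_) hY.comap_le
  simp

/-- Fubini for a past-measurable variable and the next slot. This is the Markov property in the form
in which it is used throughout; with lower integrals no integrability has to be checked. -/
lemma lintegral_past {β : Type*} [MeasurableSpace β] {n : ℕ} {Y : (ℕ → S) → β}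
    (hY : Measurable[past S n] Y) {f : β × S → ENNReal} (hf : Measurable f) :
    ∫⁻ ω, f (Y ω, ω n) ∂(Measure.infinitePi fun _ => ν) =
      ∫⁻ ω, ∫⁻ s, f (Y ω, s) ∂ν ∂(Measure.infinitePi fun _ => ν) := by
  have hY' : Measurable Y := hY.mono (past_le n) le_rfl
  have h := (indepFun_past ν hY).map_prod_eq_prod_map_map hY'.aemeasurable
    (measurable_pi_apply n).aemeasurable
  rw [Measure.infinitePi_map_eval (fun _ : ℕ => ν) n] at h
  rw [← lintegral_map (f := f) hf (hY'.prodMk (measurable_pi_apply n)), h,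
    lintegral_prod _ hf.aemeasurable, lintegral_map hf.lintegral_prod_right' hY']

lemma measureReal_past {β : Type*} [MeasurableSpace β] {n : ℕ} {Y : (ℕ → S) → β}
    (hY : Measurable[past S n] Y) {A : Set β} (hA : MeasurableSet A) {B : Set S}
    (hB : MeasurableSet B) :
    (Measure.infinitePi fun _ => ν).real {ω | Y ω ∈ A ∧ ω n ∈ B} =
      (Measure.infinitePi fun _ => ν).real {ω | Y ω ∈ A} * ν.real B := by
  have h := (indepFun_past ν hY).measure_inter_preimage_eq_mul A B hA hB
  have h2 : (Measure.infinitePi fun _ => ν) ((fun ω : ℕ → S => ω n) ⁻¹' B) = ν B := by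
    rw [← Measure.map_apply (measurable_pi_apply n) hB, Measure.infinitePi_map_eval]
  rw [h2] at h
  simp only [measureReal_def, ← ENNReal.toReal_mul]
  exact congrArg _ h

variable {ν}

/-- Bound on the exponential moment of a bounded random variable. -/
lemma lintegral_exp_le {η : S → ℝ} (hη : Measurable η) {c m θ : ℝ} (hc : ∀ s, |η s| ≤ c)
    (hm : ∫ s, η s ∂ν ≤ m) (hθ : 0 ≤ θ) (hθc : θ * c ≤ 1) :
    ∫⁻ s, ENNReal.ofReal (Real.exp (θ * η s)) ∂ν ≤ ENNReal.ofReal (1 + θ * m + (θ * c) ^ 2) := by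
  have hint : Integrable η ν := Integrable.of_bound hη.aestronglyMeasurable c
    (Eventually.of_forall fun s => by simpa using hc s)
  have hb : ∀ s, Real.exp (θ * η s) ≤ 1 + θ * η s + (θ * c) ^ 2 := fun s => by
    have h0 : |θ * η s| ≤ θ * c := by
      rw [abs_mul, abs_of_nonneg hθ]; exact mul_le_mul_of_nonneg_left (hc s) hθ
    have h1 := (abs_le.1 (Real.abs_exp_sub_one_sub_id_le (h0.trans hθc))).2
    have h2 : (θ * η s) ^ 2 ≤ (θ * c) ^ 2 := sq_le_sq.2 (h0.trans (le_abs_self _))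
    linarith
  have hi : Integrable (fun s => 1 + θ * η s + (θ * c) ^ 2) ν :=
    ((integrable_const _).add (hint.const_mul θ)).add (integrable_const _)
  calc ∫⁻ s, ENNReal.ofReal (Real.exp (θ * η s)) ∂ν
      ≤ ∫⁻ s, ENNReal.ofReal (1 + θ * η s + (θ * c) ^ 2) ∂ν :=
        lintegral_mono fun s => ENNReal.ofReal_le_ofReal (hb s)
    _ = ENNReal.ofReal (∫ s, (1 + θ * η s + (θ * c) ^ 2) ∂ν) :=
        (ofReal_integral_eq_lintegral_ofReal hi (Eventually.of_forall fun s =>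
          (Real.exp_pos _).le.trans (hb s))).symm
    _ ≤ _ := by
        refine ENNReal.ofReal_le_ofReal ?_
        rw [integral_add (f := fun s => 1 + θ * η s)
            ((integrable_const _).add (hint.const_mul θ)) (integrable_const _),
          integral_add (integrable_const _) (hint.const_mul θ), integral_const_mul]
        simp only [integral_const, probReal_univ, smul_eq_mul, one_mul]
        gcongr

/-- Chernoff's bound: Markov's inequality applied to the exponential. -/
lemma measure_ge_le_of_lintegral_exp_le {Ω : Type*} [MeasurableSpace Ω] {P : Measure Ω}
    {X : Ω → ℝ} (hX : Measurable X) {θ t K : ℝ} (hθ : 0 ≤ θ)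
    (h : ∫⁻ ω, ENNReal.ofReal (Real.exp (θ * X ω)) ∂P ≤ ENNReal.ofReal K) :
    P {ω | t ≤ X ω} ≤ ENNReal.ofReal (K * Real.exp (-(θ * t))) := by
  have h1 : ENNReal.ofReal (Real.exp (θ * t)) * P {ω | t ≤ X ω} ≤ ENNReal.ofReal K := by
    refine le_trans ?_ h
    refine le_trans ?_ (mul_meas_ge_le_lintegral
      (f := fun ω => ENNReal.ofReal (Real.exp (θ * X ω))) (by fun_prop)
      (ENNReal.ofReal (Real.exp (θ * t))))
    gcongr with ω
    intro hω
    exact ENNReal.ofReal_le_ofReal (Real.exp_le_exp.2 (mul_le_mul_of_nonneg_left hω hθ))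
  calc P {ω | t ≤ X ω} = ENNReal.ofReal (Real.exp (-(θ * t))) *
        (ENNReal.ofReal (Real.exp (θ * t)) * P {ω | t ≤ X ω}) := by
        rw [← mul_assoc, ← ENNReal.ofReal_mul (Real.exp_pos _).le, ← Real.exp_add]
        simp
    _ ≤ ENNReal.ofReal (Real.exp (-(θ * t))) * ENNReal.ofReal K := by gcongr
    _ = _ := by rw [← ENNReal.ofReal_mul (Real.exp_pos _).le, mul_comm]

/-- Borel–Cantelli for geometric tails. -/
lemma ae_eventually_lt_of_geometric {Ω : Type*} [MeasurableSpace Ω] {P : Measure Ω}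
    {X : ℕ → Ω → ℝ}
    (h : ∀ ε > 0, ∃ K ρ : ℝ, 0 ≤ K ∧ 0 ≤ ρ ∧ ρ < 1 ∧
      ∀ n : ℕ, P {ω | ε * n ≤ X n ω} ≤ ENNReal.ofReal (K * ρ ^ n)) :
    ∀ᵐ ω ∂P, ∀ ε > 0, ∀ᶠ n : ℕ in atTop, X n ω < ε * n := by
  -- The values 1 / (m + 1) of ε suffice, so that only countably many null sets are discarded.
  have key : ∀ m : ℕ, ∀ᵐ ω ∂P, ∀ᶠ n : ℕ in atTop, X n ω < (1 / ((m : ℝ) + 1)) * n := by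
    intro m
    obtain ⟨K, ρ, hK, hρ, hρ1, hb⟩ := h (1 / ((m : ℝ) + 1)) (by positivity)
    have hs : ∑' n : ℕ, P {ω | (1 / ((m : ℝ) + 1)) * n ≤ X n ω} ≠ ⊤ := by
      refine ne_top_of_le_ne_top ?_ (ENNReal.tsum_le_tsum hb)
      exact ((summable_geometric_of_lt_one hρ hρ1).mul_left K).tsum_ofReal_ne_top
    filter_upwards [ae_eventually_notMem hs] with ω hω
    filter_upwards [hω] with n hn
    simpa using hn
  filter_upwards [ae_all_iff.2 key] with ω hω ε hε
  obtain ⟨m, hm⟩ := exists_nat_one_div_lt hε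
  filter_upwards [hω m] with n hn
  exact hn.trans_le (mul_le_mul_of_nonneg_right hm.le n.cast_nonneg)

lemma tendsto_div_atTop_zero {x : ℕ → ℝ} (h1 : ∀ ε > 0, ∀ᶠ n : ℕ in atTop, x n < ε * n)
    (h2 : ∀ ε > 0, ∀ᶠ n : ℕ in atTop, -x n < ε * n) :
    Tendsto (fun n : ℕ => x n / n) atTop (𝓝 0) := by
  rw [Metric.tendsto_nhds]
  intro ε hε
  filter_upwards [h1 ε hε, h2 ε hε, eventually_gt_atTop 0] with n a b hn
  have hn' : (0 : ℝ) < n := by exact_mod_cast hn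
  rw [Real.dist_eq, sub_zero, abs_div, abs_of_pos hn', div_lt_iff₀ hn']
  exact abs_lt.2 ⟨by linarith, a⟩

/-- A sum of past-dependent weights times centred innovations has exponentially small upper
tails. -/
lemma ae_weighted_sum_lt {H : ℕ → (ℕ → S) → ℝ} (hH : ∀ n, Measurable[past S n] (H n))
    (hH1 : ∀ n ω, |H n ω| ≤ 1) {η : S → ℝ} (hη : Measurable η) (hη1 : ∀ s, |η s| ≤ 1)
    (hη0 : ∫ s, η s ∂ν = 0) :
    ∀ᵐ ω ∂(Measure.infinitePi fun _ => ν), ∀ ε > 0, ∀ᶠ n : ℕ in atTop,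
      ∑ k ∈ Finset.range n, H k ω * η (ω k) < ε * n := by
  set X : ℕ → (ℕ → S) → ℝ := fun n ω => ∑ k ∈ Finset.range n, H k ω * η (ω k)
  have hX : ∀ n, Measurable[past S n] (X n) := fun n => by
    refine Finset.measurable_fun_sum _ fun k hk => ?_
    rw [Finset.mem_range] at hk
    exact ((hH k).mono (past_mono hk.le) le_rfl).mul (hη.comp (measurable_past_eval hk))
  -- Given the past, the new term is centred and bounded by 1, so each slot multiplies the
  -- exponential moment by at most 1 + θ².
  have hmom : ∀ θ : ℝ, 0 ≤ θ → θ ≤ 1 → ∀ n,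
      ∫⁻ ω, ENNReal.ofReal (Real.exp (θ * X n ω)) ∂(Measure.infinitePi fun _ => ν) ≤
        ENNReal.ofReal ((1 + θ ^ 2) ^ n) := by
    intro θ h0 h1 n
    induction n with
    | zero => simp [X]
    | succ n ih =>
      have hYm : Measurable[past S n] fun ω => (X n ω, H n ω) := (hX n).prodMk (hH n)
      have hfm : Measurable fun p : (ℝ × ℝ) × S =>
          ENNReal.ofReal (Real.exp (θ * (p.1.1 + p.1.2 * η p.2))) := by fun_prop
      have e1 : ∀ ω, ENNReal.ofReal (Real.exp (θ * X (n + 1) ω)) =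
          ENNReal.ofReal (Real.exp (θ * (X n ω + H n ω * η (ω n)))) := fun ω => by
        simp only [X, Finset.sum_range_succ]
      simp_rw [e1]
      rw [lintegral_past ν hYm hfm]
      have e2 : ∀ ω, ∫⁻ s, ENNReal.ofReal (Real.exp (θ * (X n ω + H n ω * η s))) ∂ν ≤
          ENNReal.ofReal (Real.exp (θ * X n ω)) * ENNReal.ofReal (1 + θ ^ 2) := fun ω => by
        have e3 : ∀ s, ENNReal.ofReal (Real.exp (θ * (X n ω + H n ω * η s))) =
            ENNReal.ofReal (Real.exp (θ * X n ω)) *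
              ENNReal.ofReal (Real.exp (θ * (H n ω * η s))) := fun s => by
          rw [mul_add, Real.exp_add, ENNReal.ofReal_mul (Real.exp_pos _).le]
        simp_rw [e3]
        rw [lintegral_const_mul _ (by fun_prop)]
        gcongr
        refine (lintegral_exp_le (hη.const_mul (H n ω)) (c := 1) (m := 0) (fun s => ?_) ?_ h0
          (by linarith)).trans (by simp)
        · rw [abs_mul]; exact mul_le_one₀ (hH1 n ω) (abs_nonneg _) (hη1 s)
        · rw [integral_const_mul, hη0, mul_zero]
      refine (lintegral_mono e2).trans ?_
      have hXn : Measurable (X n) := (hX n).mono (past_le n) le_rfl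
      rw [lintegral_mul_const _ (by fun_prop), pow_succ (1 + θ ^ 2), ENNReal.ofReal_mul (by positivity)]
      gcongr
  refine ae_eventually_lt_of_geometric fun ε hε => ?_
  -- The Chernoff exponent per slot is θ² - θ ε, and θ ≤ ε / 2 makes it at most -θ².
  set θ := min 1 (ε / 2)
  have hθ0 : 0 < θ := lt_min one_pos (by positivity)
  have hθ1 : θ ≤ 1 := min_le_left _ _
  have hθ2 : θ ≤ ε / 2 := min_le_right _ _
  refine ⟨1, Real.exp (-(θ ^ 2)), zero_le_one, (Real.exp_pos _).le, ?_, fun n => ?_⟩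
  · rw [Real.exp_lt_one_iff]; have := pow_pos hθ0 2; linarith
  refine (measure_ge_le_of_lintegral_exp_le ((hX n).mono (past_le n) le_rfl) hθ0.le
    (hmom θ hθ0.le hθ1 n)).trans (ENNReal.ofReal_le_ofReal ?_)
  have h3 : (1 + θ ^ 2) ^ n ≤ Real.exp (θ ^ 2) ^ n := by
    gcongr
    have := Real.add_one_le_exp (θ ^ 2); linarith
  calc (1 + θ ^ 2) ^ n * Real.exp (-(θ * (ε * n)))
      ≤ Real.exp (θ ^ 2) ^ n * Real.exp (-(θ * (ε * n))) := by gcongr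
    _ = Real.exp (n * (θ ^ 2 - θ * ε)) := by
        rw [← Real.exp_nat_mul, ← Real.exp_add]; ring_nf
    _ ≤ Real.exp (n * (-(θ ^ 2))) := by
        gcongr
        nlinarith
    _ = 1 * Real.exp (-(θ ^ 2)) ^ n := by rw [← Real.exp_nat_mul, one_mul]

/-- Strong law of large numbers for sums of past-dependent weights times centred innovations. -/
theorem ae_weighted_average_tendsto_zero {H : ℕ → (ℕ → S) → ℝ}
    (hH : ∀ n, Measurable[past S n] (H n)) (hH1 : ∀ n ω, |H n ω| ≤ 1) {η : S → ℝ}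
    (hη : Measurable η) (hη1 : ∀ s, |η s| ≤ 1) (hη0 : ∫ s, η s ∂ν = 0) :
    ∀ᵐ ω ∂(Measure.infinitePi fun _ => ν), Tendsto
      (fun n : ℕ => (∑ k ∈ Finset.range n, H k ω * η (ω k)) / n) atTop (𝓝 0) := by
  filter_upwards [ae_weighted_sum_lt hH hH1 hη hη1 hη0,
    ae_weighted_sum_lt (η := fun s => -η s) hH hH1 hη.neg (by simpa using hη1)
      (by rw [integral_neg, hη0, neg_zero])] with ω h1 h2
  refine tendsto_div_atTop_zero h1 fun ε hε => ?_
  simpa using h2 ε hε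

end IID

/-! ### The best link: extremality and measurability -/

section BestLink

variable {N : ℕ} {S : Finset (Fin N)} {hS : S.Nonempty} {h : Fin N → ℝ}

lemma bestLink_spec :
    bestLink S hS h ∈ S.filter (fun i => ∀ j ∈ S, h j ≤ h i) :=
  Finset.min'_mem _ _

lemma bestLink_mem : bestLink S hS h ∈ S := (Finset.mem_filter.1 bestLink_spec).1

lemma le_bestLink {j : Fin N} (hj : j ∈ S) : h j ≤ h (bestLink S hS h) :=
  (Finset.mem_filter.1 bestLink_spec).2 j hj

/-- Without ties the least-index rule plays no role, so the selection commutes with renumbering the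
SUs. -/
lemma bestLink_eq_of_injective (hh : Function.Injective h) {i : Fin N} (hi : i ∈ S)
    (hmax : ∀ j ∈ S, h j ≤ h i) : bestLink S hS h = i :=
  hh (le_antisymm (hmax _ bestLink_mem) (le_bestLink hi))

lemma bestLink_eq_of_lt {i : Fin N} (hi : i ∈ S) (hmax : ∀ j ∈ S, j ≠ i → h j < h i) :
    bestLink S hS h = i := by
  by_contra hne
  exact absurd (le_bestLink (hS := hS) (h := h) hi) (not_le.2 (hmax _ bestLink_mem hne))

/-- There are finitely many values, and each fibre is a finite Boolean combination of comparisons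
between coordinates. -/
lemma measurable_bestLink (S : Finset (Fin N)) (hS : S.Nonempty) : Measurable (bestLink S hS) := by
  refine measurable_to_countable' fun i => ?_
  have : bestLink S hS ⁻¹' {i} = {h | (i ∈ S ∧ ∀ j ∈ S, h j ≤ h i) ∧
      ∀ k ∈ S, (∀ j ∈ S, h j ≤ h k) → i ≤ k} := by
    ext h
    simp only [Set.mem_preimage, Set.mem_singleton_iff, Set.mem_ofPred_eq]
    constructor
    · rintro rfl
      exact ⟨⟨bestLink_mem, fun j hj => le_bestLink hj⟩, fun k hk hk2 =>
        Finset.min'_le _ _ (Finset.mem_filter.2 ⟨hk, hk2⟩)⟩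
    · rintro ⟨h1, h2⟩
      refine le_antisymm (Finset.min'_le _ _ (Finset.mem_filter.2 h1)) ?_
      exact h2 _ bestLink_mem fun j hj => le_bestLink hj
  rw [this]
  have hm : ∀ k : Fin N, Measurable fun h : Fin N → ℝ => ∀ j ∈ S, h j ≤ h k := fun k =>
    Measurable.forall fun j => Measurable.forall fun _ => measurableSet_setOfPred.1
      (measurableSet_le (measurable_pi_apply j) (measurable_pi_apply k))
  exact measurableSet_setOfPred.2 ((measurable_const.and (hm i)).and
    (Measurable.forall fun k => Measurable.forall fun _ => (hm k).imp measurable_const))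

lemma measurable_apply_index {X : Type*} [MeasurableSpace X] {f : X → Fin N → ℝ}
    (hf : Measurable f) {g : X → Fin N} (hg : Measurable g) : Measurable fun x => f x (g x) := by
  have : Measurable fun p : (Fin N → ℝ) × Fin N => p.1 p.2 :=
    measurable_from_prod_countable_left fun i => measurable_pi_apply i
  exact this.comp (hf.prodMk hg)

end BestLink

namespace Slot

variable {N : ℕ}

lemma measurable_hp : Measurable (hp : Slot N → ℝ) := by unfold hp; fun_prop
lemma measurable_hps : Measurable (hps : Slot N → Fin N → ℝ) := by unfold hps; fun_prop
lemma measurable_hr : Measurable (hr : Slot N → Fin N → ℝ) := by unfold hr; fun_prop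
lemma measurable_hs : Measurable (hs : Slot N → Fin N → ℝ) := by unfold hs; fun_prop
lemma measurable_arrival : Measurable (arrival : Slot N → Bool) := by unfold arrival; fun_prop

end Slot

/-! ### Exponential gains: every interval is charged, ties are null -/

lemma expMeasure_Ioc_pos {r : ℝ} (hr : 0 < r) {a b : ℝ} (ha : 0 ≤ a) (hab : a < b) :
    0 < expMeasure r (Set.Ioc a b) := by
  have := isProbabilityMeasure_expMeasure hr
  rw [← measure_cdf (expMeasure r), StieltjesFunction.measure_Ioc, cdf_expMeasure_eq hr,
    cdf_expMeasure_eq hr, if_pos ha, if_pos (ha.trans hab.le), ENNReal.ofReal_pos]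
  have : Real.exp (-(r * b)) < Real.exp (-(r * a)) :=
    Real.exp_lt_exp.2 (neg_lt_neg (mul_lt_mul_of_pos_left hab hr))
  linarith

lemma nullSingletonClass_expMeasure (r : ℝ) : NullSingletonClass (expMeasure r) :=
  ⟨fun x => withDensity_absolutelyContinuous volume _ (measure_singleton x)⟩

/-- Two coordinates are independent and have no atoms, so the diagonal is null by Fubini; there are
finitely many pairs. -/
lemma ae_injective_pi_expMeasure {N : ℕ} {r : ℝ} (hr : 0 < r) :
    ∀ᵐ h ∂(Measure.pi fun _ : Fin N => expMeasure r), Function.Injective h := by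
  have := isProbabilityMeasure_expMeasure hr
  have := nullSingletonClass_expMeasure r
  have key : ∀ i j : Fin N, i ≠ j →
      ∀ᵐ h ∂(Measure.pi fun _ : Fin N => expMeasure r), h i ≠ h j := by
    intro i j hij
    have h1 := Measure.infinitePi_map_eval_prod (P := fun _ : Fin N => expMeasure r) hij
    rw [Measure.infinitePi_eq_pi] at h1
    have hd : MeasurableSet {p : ℝ × ℝ | p.1 = p.2} := 
      measurableSet_eq_fun (by fun_prop) (by fun_prop)
    have h2 : ((expMeasure r).prod (expMeasure r)) {p : ℝ × ℝ | p.1 = p.2} = 0 := by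
      rw [Measure.measure_prod_null hd]
      refine Eventually.of_forall fun x => ?_
      have : Prod.mk x ⁻¹' {p : ℝ × ℝ | p.1 = p.2} = {x} := by ext y; simp [eq_comm]
      simp only [this, measure_singleton, Pi.zero_apply]
    rw [← h1, Measure.map_apply (by fun_prop) hd] at h2
    rw [ae_iff]
    simpa using h2
  have h3 : ∀ᵐ h ∂(Measure.pi fun _ : Fin N => expMeasure r), ∀ i j : Fin N, i ≠ j → h i ≠ h j := by
    rw [ae_all_iff]; intro i; rw [ae_all_iff]; intro j
    by_cases hij : i = j
    · exact Eventually.of_forall fun _ h => absurd hij h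
    · filter_upwards [key i j hij] with h hh _ using hh
  filter_upwards [h3] with h hh i j hij
  by_contra hne
  exact hh i j hne hij

/-! ### The law of one slot -/

namespace Network

variable (G : Network)

/-- Joint law of the channel gains in one slot. -/
def gainLaw : Measure (ℝ × (Fin G.N → ℝ) × (Fin G.N → ℝ) × (Fin G.N → ℝ)) :=
  (expMeasure (1 / G.σp2)).prod <|
    (Measure.pi fun _ => expMeasure (1 / G.σ2)).prod <|
      (Measure.pi fun _ => expMeasure (1 / G.σ2)).prod <|
        Measure.pi fun _ => expMeasure (1 / G.σ2)

instance isProbabilityMeasure_expMeasure_primary : IsProbabilityMeasure (expMeasure (1 / G.σp2)) :=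
  isProbabilityMeasure_expMeasure (one_div_pos.2 G.σp2_pos)

instance isProbabilityMeasure_expMeasure_common : IsProbabilityMeasure (expMeasure (1 / G.σ2)) :=
  isProbabilityMeasure_expMeasure (one_div_pos.2 G.σ2_pos)

instance isProbabilityMeasure_gainLaw : IsProbabilityMeasure G.gainLaw := by
  unfold gainLaw; infer_instance

lemma slotLaw_eq_prod (lam : unitInterval) :
    G.slotLaw lam = (bernoulliMeasure true false lam).prod G.gainLaw := rfl

instance isProbabilityMeasure_slotLaw (lam : unitInterval) :
    IsProbabilityMeasure (G.slotLaw lam) := by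
  rw [slotLaw_eq_prod]; infer_instance

instance isProbabilityMeasure_law (lam : unitInterval) : IsProbabilityMeasure (G.law lam) := by
  unfold law; infer_instance

/-- The arrival rate plays no role in the probability of an event that involves gains only. -/
lemma slotLaw_real_eq_of_gains {E : Set (Slot G.N)} (hE : MeasurableSet E)
    (h : ∀ b c y, (b, y) ∈ E → (c, y) ∈ E) (lam : unitInterval) :
    (G.slotLaw lam).real E = (G.slotLaw 0).real E := by
  have key : ∀ l, (G.slotLaw l).real E = G.gainLaw.real {y | (true, y) ∈ E} := fun l => by
    have hE' : MeasurableSet {y | (true, y) ∈ E} := measurable_prodMk_left hE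
    rw [← (measurePreserving_snd (μ := bernoulliMeasure true false l)
      (ν := G.gainLaw)).measureReal_preimage hE'.nullMeasurableSet, slotLaw_eq_prod]
    congr 1
    ext ⟨b, y⟩
    exact ⟨h b true y, h true b y⟩
  rw [key, key]

/-! ### Measurability of allocations and success events -/

section Measurability

variable {X : Type*} [MeasurableSpace X]

lemma measurableSet_supports {P h I : X → ℝ} (hP : Measurable P) (hh : Measurable h)
    (hI : Measurable I) : MeasurableSet {x | G.Supports (P x) (h x) (I x)} := by
  unfold Supports Real.logb
  exact measurableSet_le measurable_const
    ((Real.measurable_log.comp (measurable_const.add ((hP.mul hh).div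
      (measurable_const.add hI)))).div_const _)

lemma measurable_minPower {h I : X → ℝ} (hh : Measurable h) (hI : Measurable I) :
    Measurable fun x => G.minPower (h x) (I x) := by
  unfold minPower; fun_prop

lemma measurable_alonePower {h : X → ℝ} (hh : Measurable h) :
    Measurable fun x => G.alonePower (h x) := by
  have hm := G.measurable_minPower hh (measurable_const (a := (0 : ℝ)))
  unfold alonePower
  cases G.power
  · exact measurable_const
  · exact Measurable.ite (measurableSet_le hm measurable_const) hm measurable_const

lemma measurable_best : Measurable G.best := measurable_bestLink _ G.univ_nonempty

lemma measurable_bestExcept_uncurry :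
    Measurable fun p : (Fin G.N → ℝ) × Fin G.N => G.bestExcept p.2 p.1 :=
  have h : ∀ i : Fin G.N, Measurable (G.bestExcept i) := fun i =>
    measurable_bestLink _ (G.erase_nonempty i)
  measurable_from_prod_countable_left h

lemma measurable_bestExcept {i : X → Fin G.N} (hi : Measurable i) {h : X → Fin G.N → ℝ}
    (hh : Measurable h) : Measurable fun x => G.bestExcept (i x) (h x) := by
  have := G.measurable_bestExcept_uncurry.comp (hh.prodMk hi)
  exact this

lemma measurable_selectPair : Measurable G.selectPair := by
  have h1 := G.measurable_best.comp (Slot.measurable_hs (N := G.N))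
  have h2 := G.measurable_best.comp (Slot.measurable_hr (N := G.N))
  unfold selectPair
  cases G.selection
  · exact h1.prodMk (G.measurable_bestExcept h1 Slot.measurable_hr)
  · exact (G.measurable_bestExcept h2 Slot.measurable_hs).prodMk h2

lemma measurable_jointAllocation :
    Measurable (fun x => (G.jointAllocation x).s) ∧ Measurable (fun x => (G.jointAllocation x).r) ∧
    Measurable (fun x => (G.jointAllocation x).Ps) ∧
    Measurable (fun x => (G.jointAllocation x).Pr) := by
  have hs := G.measurable_selectPair.fst
  have hr := G.measurable_selectPair.snd
  have bs := G.measurable_best.comp (Slot.measurable_hs (N := G.N))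
  have br := G.measurable_best.comp (Slot.measurable_hr (N := G.N))
  have hPs := G.measurable_minPower (measurable_apply_index Slot.measurable_hs hs)
    (measurable_const (a := (0 : ℝ)))
  have hPr := G.measurable_minPower (measurable_apply_index Slot.measurable_hr hr)
    (hPs.mul (measurable_apply_index Slot.measurable_hr hs))
  have as := G.measurable_alonePower (measurable_apply_index Slot.measurable_hs bs)
  have ar := G.measurable_alonePower (measurable_apply_index Slot.measurable_hr br)
  have c1 := measurableSet_le hPs (measurable_const (a := G.Pmax))
  have c2 := measurableSet_le hPr (measurable_const (a := G.Pmax))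
  unfold jointAllocation
  cases G.power
  · exact ⟨hs, hr, measurable_const, measurable_const⟩
  · simp only [apply_ite Allocation.s, apply_ite Allocation.r, apply_ite Allocation.Ps,
      apply_ite Allocation.Pr]
    exact ⟨.ite c1 (.ite c2 hs bs) hs, .ite c1 (.ite c2 hr hr) br,
      .ite c1 (.ite c2 hPs as) measurable_const, .ite c1 (.ite c2 hPr measurable_const) ar⟩

lemma measurableSet_directOK : MeasurableSet {x | G.DirectOK x} :=
  G.measurableSet_supports measurable_const Slot.measurable_hp measurable_const

lemma measurableSet_overheardOK : MeasurableSet {x | G.OverheardOK x} := by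
  have : {x | G.OverheardOK x} = ⋃ i, {x : Slot G.N | G.Supports G.P₀ (x.hps i) 0} := by
    ext x; simp [OverheardOK]
  rw [this]
  exact MeasurableSet.iUnion fun i => G.measurableSet_supports measurable_const
    ((measurable_pi_apply i).comp Slot.measurable_hps) measurable_const

lemma measurableSet_relayOK : MeasurableSet {x | G.RelayOK (G.jointAllocation x) x} := by
  obtain ⟨hs, hr, hPs, hPr⟩ := G.measurable_jointAllocation
  exact G.measurableSet_supports hPr (measurable_apply_index Slot.measurable_hr hr)
    (hPs.mul (measurable_apply_index Slot.measurable_hr hs))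

lemma measurableSet_secondaryOK {a : Slot G.N → Allocation G.N} (hs : Measurable fun x => (a x).s)
    (hPs : Measurable fun x => (a x).Ps) : MeasurableSet {x | G.SecondaryOK (a x) x} :=
  G.measurableSet_supports hPs (measurable_apply_index Slot.measurable_hs hs) measurable_const

lemma measurable_aloneAllocation_s : Measurable fun x => (G.aloneAllocation x).s :=
  G.measurable_best.comp (Slot.measurable_hs (N := G.N))

lemma measurable_aloneAllocation_Ps : Measurable fun x => (G.aloneAllocation x).Ps :=
  G.measurable_alonePower
    (measurable_apply_index Slot.measurable_hs G.measurable_aloneAllocation_s)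

end Measurability

/-! ### Probabilities of the slot events -/

section Probabilities

variable (lam : unitInterval)

lemma slotLaw_directOK : (G.slotLaw lam).real {x | G.DirectOK x} = G.fp :=
  G.slotLaw_real_eq_of_gains G.measurableSet_directOK (fun _ _ _ h => h) lam

lemma slotLaw_relayOK :
    (G.slotLaw lam).real {x | G.RelayOK (G.jointAllocation x) x} = G.fr :=
  G.slotLaw_real_eq_of_gains G.measurableSet_relayOK (fun _ _ _ h => h) lam

lemma slotLaw_secondaryOK_joint :
    (G.slotLaw lam).real {x | G.SecondaryOK (G.jointAllocation x) x} = G.fsBusy :=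
  G.slotLaw_real_eq_of_gains (G.measurableSet_secondaryOK G.measurable_jointAllocation.1
    G.measurable_jointAllocation.2.2.1) (fun _ _ _ h => h) lam

lemma slotLaw_secondaryOK_alone :
    (G.slotLaw lam).real {x | G.SecondaryOK (G.aloneAllocation x) x} = G.fsEmpty :=
  G.slotLaw_real_eq_of_gains (G.measurableSet_secondaryOK G.measurable_aloneAllocation_s
    G.measurable_aloneAllocation_Ps) (fun _ _ _ h => h) lam

lemma slotLaw_arrival : (G.slotLaw lam).real {x | x.arrival = true} = lam := by
  have : {x : Slot G.N | x.arrival = true} = {true} ×ˢ Set.univ := by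
    ext x; simp [Slot.arrival]
  rw [this, slotLaw_eq_prod, measureReal_prod_prod]
  simp

/-- Probability that a PU packet is overheard by some SU but missed by the primary destination. -/
lemma slotLaw_overheard_not_direct :
    (G.slotLaw lam).real {x | ¬ G.DirectOK x ∧ G.OverheardOK x} = (1 - G.fp) * G.fps := by
  have hD : MeasurableSet {h : ℝ | G.Supports G.P₀ h 0} :=
    G.measurableSet_supports measurable_const measurable_id measurable_const
  have e1 : {x : Slot G.N | ¬ G.DirectOK x ∧ G.OverheardOK x} =
      Set.univ ×ˢ ({h : ℝ | G.Supports G.P₀ h 0}ᶜ ×ˢ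
        ({h : Fin G.N → ℝ | ∃ i, G.Supports G.P₀ (h i) 0} ×ˢ Set.univ)) := by
    ext x; simp [DirectOK, OverheardOK, Slot.hp, Slot.hps]
  have e2 : {x : Slot G.N | G.DirectOK x} =
      Set.univ ×ˢ ({h : ℝ | G.Supports G.P₀ h 0} ×ˢ Set.univ) := by
    ext x; simp [DirectOK, Slot.hp]
  have e3 : {x : Slot G.N | G.OverheardOK x} =
      Set.univ ×ˢ (Set.univ ×ˢ
        ({h : Fin G.N → ℝ | ∃ i, G.Supports G.P₀ (h i) 0} ×ˢ Set.univ)) := by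
    ext x; simp [OverheardOK, Slot.hps]
  rw [fp, fps, e1, e2, e3]
  simp only [slotLaw, measureReal_prod_prod, probReal_univ, one_mul, mul_one,
    probReal_compl_eq_one_sub hD]

lemma slotLaw_leaves :
    (G.slotLaw lam).real {x | G.DirectOK x ∨ G.OverheardOK x} = G.μp := by
  have e : {x : Slot G.N | G.DirectOK x ∨ G.OverheardOK x} =
      {x | G.DirectOK x} ∪ {x | ¬ G.DirectOK x ∧ G.OverheardOK x} := by
    ext x; by_cases h : G.DirectOK x <;> simp [h]
  have hd : Disjoint {x | G.DirectOK x} {x | ¬ G.DirectOK x ∧ G.OverheardOK x} :=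
    Set.disjoint_left.2 fun x h1 h2 => h2.1 h1
  rw [e, measureReal_union hd
    (show MeasurableSet {x | ¬ G.DirectOK x ∧ G.OverheardOK x} from
      G.measurableSet_directOK.compl.inter G.measurableSet_overheardOK), slotLaw_directOK,
    slotLaw_overheard_not_direct, μp]

lemma fp_le_one : G.fp ≤ 1 := measureReal_le_one
lemma fps_nonneg : 0 ≤ G.fps := measureReal_nonneg
lemma fps_le_one : G.fps ≤ 1 := measureReal_le_one

lemma threshold_pos : 0 < (2 : ℝ) ^ G.R₀ - 1 :=
  sub_pos.2 (Real.one_lt_rpow one_lt_two G.R₀_pos)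

/-- The rate condition with the logarithm and the quotient cleared. -/
lemma supports_of_le {P h I : ℝ} (hI : 0 ≤ I)
    (hle : ((2 : ℝ) ^ G.R₀ - 1) * (G.N₀ + I) ≤ P * h) : G.Supports P h I := by
  have hN : 0 < G.N₀ + I := add_pos_of_pos_of_nonneg G.N₀_pos hI
  have h1 : (2 : ℝ) ^ G.R₀ - 1 ≤ P * h / (G.N₀ + I) := (le_div_iff₀ hN).2 hle
  have h2 := G.threshold_pos
  exact (Real.le_logb_iff_rpow_le one_lt_two (by linarith)).2 (by linarith)

/-- The relay link works if the gains single out an SU `i₀` with a good secondary link and little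
interference as secondary transmitter, while all the other SUs are good relays. -/
lemma relayOK_of_gains {x : Slot G.N} {i₀ : Fin G.N} {M : ℝ} (hM : 1 < M)
    (hMs : ((2 : ℝ) ^ G.R₀ - 1) * G.N₀ ≤ G.Pmax * M)
    (hMr : ((2 : ℝ) ^ G.R₀ - 1) * (G.N₀ + G.Pmax) ≤ G.Pmax * M)
    (h1 : 2 * M ≤ x.hs i₀) (h2 : ∀ i, i ≠ i₀ → x.hs i ≤ M) (h3 : 0 ≤ x.hr i₀) (h4 : x.hr i₀ ≤ 1)
    (h5 : ∀ i, i ≠ i₀ → M ≤ x.hr i) : G.RelayOK (G.jointAllocation x) x := by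
  have hsel : (G.selectPair x).1 = i₀ ∧ (G.selectPair x).2 ≠ i₀ := by
    unfold selectPair
    cases G.selection
    · have hb : G.best x.hs = i₀ := bestLink_eq_of_lt (Finset.mem_univ _) fun j _ hj => by
        have := h2 j hj; linarith
      refine ⟨hb, ?_⟩
      have := bestLink_mem (hS := G.erase_nonempty (G.best x.hs)) (h := x.hr)
      rw [Finset.mem_erase, hb] at this
      simpa [bestExcept, hb] using this.1
    -- Since there are at least two SUs, some other SU has gain at least M > 1 to the primary
    -- destination, while that of `i₀` is at most 1.
    · have hb : G.best x.hr ≠ i₀ := fun hb => by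
        obtain ⟨j, hj⟩ := G.erase_nonempty i₀
        have a := le_bestLink (hS := G.univ_nonempty) (h := x.hr) (Finset.mem_univ j)
        have b := h5 j (Finset.ne_of_mem_erase hj)
        change x.hr j ≤ x.hr (G.best x.hr) at a
        rw [hb] at a
        linarith
      refine ⟨bestLink_eq_of_lt (hS := G.erase_nonempty _) (by simpa using hb.symm) fun j _ hj => ?_, hb⟩
      have := h2 j hj; linarith
  obtain ⟨hs, hr⟩ := hsel
  set r := (G.selectPair x).2 with hrdef
  have hxr : M ≤ x.hr r := h5 r hr
  have hPm := G.Pmax_pos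
  have hN := G.N₀_pos
  have hc := G.threshold_pos
  have hxr0 : 0 < x.hr r := by linarith
  have hxs0 : 0 < x.hs i₀ := by linarith
  unfold RelayOK jointAllocation
  rw [hs, ← hrdef]
  cases G.power
  -- Equal power: the interfering gain is at most 1, so the interference is at most `Pmax`.
  · refine G.supports_of_le (by positivity) ?_
    change _ * (G.N₀ + G.Pmax * x.hr i₀) ≤ G.Pmax * x.hr r
    have : ((2 : ℝ) ^ G.R₀ - 1) * (G.N₀ + G.Pmax * x.hr i₀) ≤
        ((2 : ℝ) ^ G.R₀ - 1) * (G.N₀ + G.Pmax * 1) := by gcongr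
    have h6 : G.Pmax * M ≤ G.Pmax * x.hr r := by gcongr
    rw [mul_one] at this
    linarith
  -- Adaptive power: neither SU is silenced, and the relay then meets the rate condition with
  -- equality.
  · have hPs0 : 0 ≤ G.minPower (x.hs i₀) 0 := by unfold minPower; positivity
    have hPs : G.minPower (x.hs i₀) 0 ≤ G.Pmax := by
      unfold minPower
      rw [div_le_iff₀ hxs0, add_zero]
      have : G.Pmax * M ≤ G.Pmax * x.hs i₀ := by gcongr; linarith
      linarith
    have hPr : G.minPower (x.hr r) (G.minPower (x.hs i₀) 0 * x.hr i₀) ≤ G.Pmax := by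
      have h7 : G.minPower (x.hs i₀) 0 * x.hr i₀ ≤ G.Pmax * 1 := by gcongr
      have h6 : G.Pmax * M ≤ G.Pmax * x.hr r := by gcongr
      have h8 : ((2 : ℝ) ^ G.R₀ - 1) * (G.N₀ + G.minPower (x.hs i₀) 0 * x.hr i₀) ≤
        ((2 : ℝ) ^ G.R₀ - 1) * (G.N₀ + G.Pmax) := by gcongr; linarith
      rw [minPower, div_le_iff₀ hxr0]
      linarith
    simp only [if_pos hPs, if_pos hPr]
    refine G.supports_of_le (by positivity) (le_of_eq ?_)
    rw [minPower.eq_def G (x.hr r), div_mul_cancel₀ _ hxr0.ne']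

/-- With positive probability nothing arrives and both the direct link and the relay link work. -/
lemma slotLaw_serve_pos (hlam : lam < 1) :
    0 < (G.slotLaw lam).real {x | x.arrival = false ∧ G.DirectOK x ∧
      G.RelayOK (G.jointAllocation x) x} := by
  set c := (2 : ℝ) ^ G.R₀ - 1
  have hc : 0 < c := G.threshold_pos
  have hPm := G.Pmax_pos
  have hN := G.N₀_pos
  have hP0 := G.P₀_pos
  set i₀ : Fin G.N := ⟨0, lt_of_lt_of_le two_pos G.two_le_N⟩
  -- A gain of M, used with power `Pmax`, overcomes the noise plus the interference `Pmax` caused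
  -- through a gain of at most 1. The summand 2 ensures M > 1.
  set M := 2 + c * (G.N₀ + G.Pmax) / G.Pmax with hMdef
  have hM : 1 < M := by
    have : 0 < c * (G.N₀ + G.Pmax) / G.Pmax := by positivity
    linarith
  have hMr : c * (G.N₀ + G.Pmax) ≤ G.Pmax * M := by
    rw [hMdef, mul_add G.Pmax, mul_div_cancel₀ _ hPm.ne']; linarith
  have hMs : c * G.N₀ ≤ G.Pmax * M := by
    refine le_trans ?_ hMr
    gcongr
    linarith
  set t := c * G.N₀ / G.P₀ with htdef
  have ht : 0 < t := by positivity
  -- A box of gains of positive probability: A bounds the gains to the primary destination and B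
  -- those to the secondary one. In it `i₀` is the clear choice as secondary transmitter and all the
  -- others are good relays.
  set A : Fin G.N → Set ℝ := fun i => if i = i₀ then Set.Ioc 0 1 else Set.Ioc M (M + 1)
  set B : Fin G.N → Set ℝ := fun i => if i = i₀ then Set.Ioc (2 * M) (2 * M + 1) else Set.Ioc 0 M
  have hσ := one_div_pos.2 G.σ2_pos
  have hA : 0 < (Measure.pi fun _ : Fin G.N => expMeasure (1 / G.σ2)) (Set.univ.pi A) := by
    rw [Measure.pi_pi, pos_iff_ne_zero, Finset.prod_ne_zero_iff]
    intro i _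
    simp only [A]
    split_ifs
    · exact (expMeasure_Ioc_pos hσ le_rfl one_pos).ne'
    · exact (expMeasure_Ioc_pos hσ (by linarith) (by linarith)).ne'
  have hB : 0 < (Measure.pi fun _ : Fin G.N => expMeasure (1 / G.σ2)) (Set.univ.pi B) := by
    rw [Measure.pi_pi, pos_iff_ne_zero, Finset.prod_ne_zero_iff]
    intro i _
    simp only [B]
    split_ifs
    · exact (expMeasure_Ioc_pos hσ (by linarith) (by linarith)).ne'
    · exact (expMeasure_Ioc_pos hσ le_rfl (by linarith)).ne'
  have hD : 0 < (expMeasure (1 / G.σp2)) (Set.Ioc t (t + 1)) :=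
    expMeasure_Ioc_pos (one_div_pos.2 G.σp2_pos) ht.le (by linarith)
  have hb : 0 < bernoulliMeasure true false lam {false} := by
    rw [pos_iff_ne_zero, ne_eq,
      ← measureReal_eq_zero_iff (measure_ne_top _ _)]
    have : (lam : ℝ) < 1 := hlam
    simp
    linarith
  have hbox : 0 < G.slotLaw lam ({false} ×ˢ (Set.Ioc t (t + 1) ×ˢ
      ((Set.univ : Set (Fin G.N → ℝ)) ×ˢ (Set.univ.pi A ×ˢ Set.univ.pi B)))) := by
    simp only [slotLaw, Measure.prod_prod, measure_univ, one_mul]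
    exact ENNReal.mul_pos hb.ne' (ENNReal.mul_pos hD.ne' (ENNReal.mul_pos hA.ne' hB.ne').ne').ne'
  refine ENNReal.toReal_pos (hbox.trans_le (measure_mono ?_)).ne' (by finiteness)
  rintro ⟨b, hp, hps, hr, hs⟩ ⟨h1, h2, -, h3, h4⟩
  refine ⟨h1, ?_, ?_⟩
  · refine G.supports_of_le le_rfl ?_
    have h5 : G.P₀ * t ≤ G.P₀ * hp := mul_le_mul_of_nonneg_left h2.1.le hP0.le
    rw [htdef, mul_div_cancel₀ _ hP0.ne'] at h5
    rw [add_zero]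
    exact h5
  · have hA0 := h3 i₀ trivial
    have hB0 := h4 i₀ trivial
    simp only [A, B, if_pos] at hA0 hB0
    refine G.relayOK_of_gains (i₀ := i₀) hM hMs hMr hB0.1.le (fun i hi => ?_) hA0.1.le hA0.2
      fun i hi => ?_
    · have := h4 i trivial
      simp only [B, if_neg hi] at this
      exact this.2
    · have := h3 i trivial
      simp only [A, if_neg hi] at this
      exact this.1.le

lemma fr_pos : 0 < G.fr :=
  (G.slotLaw_serve_pos 0 (by simp)).trans_le (measureReal_mono fun _ h => h.2.2)

lemma fp_pos : 0 < G.fp :=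
  (G.slotLaw_serve_pos 0 (by simp)).trans_le (measureReal_mono fun _ h => h.2.1)

end Probabilities

/-! ### Exchangeability of the SUs -/

section Symmetry

/-- Renumbering the SUs. -/
def relabel {N : ℕ} (τ : Equiv.Perm (Fin N)) (x : Slot N) : Slot N :=
  (x.arrival, x.hp, x.hps ∘ τ, x.hr ∘ τ, x.hs ∘ τ)

/-- A product of identical factors is invariant under permutations of the coordinates; this is where
the common mean of the gains enters. -/
lemma measurePreserving_relabel (lam : unitInterval) (τ : Equiv.Perm (Fin G.N)) :
    MeasurePreserving (relabel τ) (G.slotLaw lam) (G.slotLaw lam) := by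
  have h1 : MeasurePreserving (fun h : Fin G.N → ℝ => h ∘ τ)
      (Measure.pi fun _ => expMeasure (1 / G.σ2)) (Measure.pi fun _ => expMeasure (1 / G.σ2)) := by
    refine ⟨measurable_pi_lambda _ fun i => measurable_pi_apply _, ?_⟩
    have := Measure.map_infinitePi_infinitePi_of_inj (P := fun _ : Fin G.N => expMeasure (1 / G.σ2))
      τ.injective
    rwa [Measure.infinitePi_eq_pi] at this
  exact (MeasurePreserving.id _).prod ((MeasurePreserving.id _).prod (h1.prod (h1.prod h1)))

lemma ae_injective_gains (lam : unitInterval) :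
    ∀ᵐ x ∂G.slotLaw lam, Function.Injective x.hr ∧ Function.Injective x.hs := by
  have h := ae_injective_pi_expMeasure (N := G.N) (one_div_pos.2 G.σ2_pos)
  have hs : MeasurePreserving (Slot.hs (N := G.N)) (G.slotLaw lam)
      (Measure.pi fun _ => expMeasure (1 / G.σ2)) :=
    measurePreserving_snd.comp (measurePreserving_snd.comp
      (measurePreserving_snd.comp measurePreserving_snd))
  have hr : MeasurePreserving (Slot.hr (N := G.N)) (G.slotLaw lam)
      (Measure.pi fun _ => expMeasure (1 / G.σ2)) :=
    measurePreserving_fst.comp (measurePreserving_snd.comp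
      (measurePreserving_snd.comp measurePreserving_snd))
  exact (hr.quasiMeasurePreserving.ae h).and (hs.quasiMeasurePreserving.ae h)

variable {G} in
lemma best_comp (τ : Equiv.Perm (Fin G.N)) {h : Fin G.N → ℝ} (hh : Function.Injective h) :
    G.best (h ∘ τ) = τ.symm (G.best h) := by
  refine bestLink_eq_of_injective (hh.comp τ.injective) (Finset.mem_univ _) fun j _ => ?_
  rw [Function.comp_apply, Function.comp_apply, Equiv.apply_symm_apply]
  exact le_bestLink (hS := G.univ_nonempty) (h := h) (Finset.mem_univ (τ j))

variable {G} in
lemma bestExcept_comp (τ : Equiv.Perm (Fin G.N)) {h : Fin G.N → ℝ} (hh : Function.Injective h)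
    (i : Fin G.N) : G.bestExcept (τ.symm i) (h ∘ τ) = τ.symm (G.bestExcept i h) := by
  refine bestLink_eq_of_injective (hh.comp τ.injective) ?_ fun j hj => ?_
  · have := bestLink_mem (hS := G.erase_nonempty i) (h := h)
    simp only [Finset.mem_erase, Finset.mem_univ, and_true] at this ⊢
    exact fun h => this (τ.symm.injective h)
  · have hj' : τ j ∈ Finset.univ.erase i := by
      simp only [Finset.mem_erase, Finset.mem_univ, and_true] at hj ⊢
      rintro rfl
      simp at hj
    rw [Function.comp_apply, Function.comp_apply, Equiv.apply_symm_apply]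
    exact le_bestLink (hS := G.erase_nonempty i) (h := h) hj'

/-- Injectivity cannot be dropped: breaking ties by the least index is not equivariant. -/
lemma selectPair_relabel (τ : Equiv.Perm (Fin G.N)) {x : Slot G.N} (hr : Function.Injective x.hr)
    (hs : Function.Injective x.hs) : G.selectPair (relabel τ x) =
      (τ.symm (G.selectPair x).1, τ.symm (G.selectPair x).2) := by
  change (match G.selection with
    | .bestSecondary => (G.best (x.hs ∘ τ), G.bestExcept (G.best (x.hs ∘ τ)) (x.hr ∘ τ))
    | .bestPrimary => (G.bestExcept (G.best (x.hr ∘ τ)) (x.hs ∘ τ), G.best (x.hr ∘ τ))) = _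
  unfold selectPair
  cases G.selection <;> simp only [best_comp τ hr, best_comp τ hs, bestExcept_comp τ hr,
    bestExcept_comp τ hs]

lemma jointAllocation_relabel (τ : Equiv.Perm (Fin G.N)) {x : Slot G.N}
    (hr : Function.Injective x.hr) (hs : Function.Injective x.hs) :
    (G.jointAllocation (relabel τ x)).s = τ.symm (G.jointAllocation x).s ∧
      (G.jointAllocation (relabel τ x)).Ps = (G.jointAllocation x).Ps := by
  have e1 : (relabel τ x).hs = x.hs ∘ τ := rfl
  have e2 : (relabel τ x).hr = x.hr ∘ τ := rfl
  unfold jointAllocation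
  rw [selectPair_relabel G τ hr hs, e1, e2, best_comp τ hr, best_comp τ hs]
  cases G.power
  · exact ⟨rfl, rfl⟩
  · simp only [Function.comp_apply, Equiv.apply_symm_apply]
    split_ifs <;> exact ⟨rfl, rfl⟩

lemma aloneAllocation_relabel (τ : Equiv.Perm (Fin G.N)) {x : Slot G.N}
    (hs : Function.Injective x.hs) :
    (G.aloneAllocation (relabel τ x)).s = τ.symm (G.aloneAllocation x).s ∧
      (G.aloneAllocation (relabel τ x)).Ps = (G.aloneAllocation x).Ps := by
  have e1 : (relabel τ x).hs = x.hs ∘ τ := rfl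
  unfold aloneAllocation
  simp only [e1, best_comp τ hs, Function.comp_apply, Equiv.apply_symm_apply, and_self]

/-- By symmetry, every SU has the same share in the successful secondary transmissions. -/
lemma slotLaw_secondary_share (lam : unitInterval) {a : Slot G.N → Allocation G.N}
    (hms : Measurable fun x => (a x).s) (hmP : Measurable fun x => (a x).Ps)
    (ha : ∀ τ x, Function.Injective x.hr → Function.Injective x.hs →
      (a (relabel τ x)).s = τ.symm (a x).s ∧ (a (relabel τ x)).Ps = (a x).Ps) (i : Fin G.N) :
    (G.slotLaw lam).real {x | (a x).s = i ∧ G.SecondaryOK (a x) x} =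
      1 / G.N * (G.slotLaw lam).real {x | G.SecondaryOK (a x) x} := by
  have hOK := G.measurableSet_secondaryOK hms hmP
  have hm : ∀ i, MeasurableSet {x | (a x).s = i ∧ G.SecondaryOK (a x) x} := fun i =>
    (hms (measurableSet_singleton i)).inter hOK
  have hsw : ∀ j, (G.slotLaw lam).real {x | (a x).s = j ∧ G.SecondaryOK (a x) x} =
      (G.slotLaw lam).real {x | (a x).s = i ∧ G.SecondaryOK (a x) x} := by
    intro j
    -- The transposition of i and j preserves the law and, outside the null set of ties, carries the
    -- event of j to that of i.
    rw [← (G.measurePreserving_relabel lam (Equiv.swap i j)).measureReal_preimage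
      (hm i).nullMeasurableSet]
    refine measureReal_congr ?_
    filter_upwards [G.ae_injective_gains lam] with x hx
    obtain ⟨h1, h2⟩ := ha (Equiv.swap i j) x hx.1 hx.2
    refine propext ?_
    change ((a x).s = j ∧ G.SecondaryOK (a x) x) ↔ ((a (relabel (Equiv.swap i j) x)).s = i ∧
      G.SecondaryOK (a (relabel (Equiv.swap i j) x)) (relabel (Equiv.swap i j) x))
    have h3 : (relabel (Equiv.swap i j) x).hs = x.hs ∘ Equiv.swap i j := rfl
    unfold SecondaryOK
    rw [h1, h2, h3, Function.comp_apply, Equiv.apply_symm_apply, Equiv.symm_apply_eq,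
      Equiv.swap_apply_left]
  have hsum : (G.slotLaw lam).real {x | G.SecondaryOK (a x) x} =
      ∑ j, (G.slotLaw lam).real {x | (a x).s = j ∧ G.SecondaryOK (a x) x} := by
    rw [← measureReal_iUnion_fintype _ hm]
    · congr 1; ext x; simp
    · intro j k hjk
      exact Set.disjoint_left.2 fun x h1 h2 => hjk (h1.1.symm.trans h2.1)
  have hN : (G.N : ℝ) ≠ 0 := by have := G.two_le_N; positivity
  rw [hsum, Finset.sum_congr rfl fun j _ => hsw j]
  simp only [Finset.sum_const, Finset.card_univ, Fintype.card_fin, nsmul_eq_mul]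
  field_simp

lemma slotLaw_secondary_share_joint (lam : unitInterval) (i : Fin G.N) :
    (G.slotLaw lam).real {x | (G.jointAllocation x).s = i ∧
      G.SecondaryOK (G.jointAllocation x) x} = 1 / G.N * G.fsBusy := by
  rw [← G.slotLaw_secondaryOK_joint lam]
  exact G.slotLaw_secondary_share lam G.measurable_jointAllocation.1
    G.measurable_jointAllocation.2.2.1 (fun τ x hr hs => G.jointAllocation_relabel τ hr hs) i

lemma slotLaw_secondary_share_alone (lam : unitInterval) (i : Fin G.N) :
    (G.slotLaw lam).real {x | (G.aloneAllocation x).s = i ∧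
      G.SecondaryOK (G.aloneAllocation x) x} = 1 / G.N * G.fsEmpty := by
  rw [← G.slotLaw_secondaryOK_alone lam]
  exact G.slotLaw_secondary_share lam G.measurable_aloneAllocation_s
    G.measurable_aloneAllocation_Ps (fun τ x _ hs => G.aloneAllocation_relabel τ hs) i

end Symmetry

end Network

/-! ### Real-valued indicators -/

open Classical in
/-- The real indicator of a proposition. -/
def ind (p : Prop) : ℝ := if p then 1 else 0

lemma ind_nonneg (p : Prop) : 0 ≤ ind p := by unfold ind; split_ifs <;> norm_num
lemma ind_le_one (p : Prop) : ind p ≤ 1 := by unfold ind; split_ifs <;> norm_num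
@[simp] lemma ind_of_true {p : Prop} (h : p) : ind p = 1 := if_pos h
@[simp] lemma ind_of_false {p : Prop} (h : ¬ p) : ind p = 0 := if_neg h

lemma ind_and (p q : Prop) : ind (p ∧ q) = ind p * ind q := by
  by_cases hp : p <;> by_cases hq : q <;> simp [hp, hq]

lemma ind_or {p q : Prop} (h : ¬ (p ∧ q)) : ind (p ∨ q) = ind p + ind q := by
  by_cases hp : p <;> by_cases hq : q <;> simp_all

lemma measurable_ind {X : Type*} [MeasurableSpace X] {p : X → Prop}
    (hp : MeasurableSet {x | p x}) : Measurable fun x => ind (p x) := by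
  unfold ind
  exact Measurable.ite hp measurable_const measurable_const

lemma integral_ind {X : Type*} [MeasurableSpace X] {μ : Measure X} {p : X → Prop}
    (hp : MeasurableSet {x | p x}) : ∫ x, ind (p x) ∂μ = μ.real {x | p x} := by
  rw [← integral_indicator_one hp]
  rfl

lemma integrable_ind {X : Type*} [MeasurableSpace X] {μ : Measure X} [IsFiniteMeasure μ]
    {p : X → Prop} (hp : MeasurableSet {x | p x}) : Integrable (fun x => ind (p x)) μ :=
  Integrable.of_bound (measurable_ind hp).aestronglyMeasurable 1
    (Eventually.of_forall fun x => by
      rw [Real.norm_of_nonneg (ind_nonneg _)]; exact ind_le_one _)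

namespace Network

variable (G : Network)

/-- Probability that a PU packet moves to the relay queue, once transmitted. -/
def relayArrivalProb : ℝ := (1 - G.fp) * G.fps

lemma relayArrivalProb_nonneg : 0 ≤ G.relayArrivalProb :=
  mul_nonneg (sub_nonneg.2 G.fp_le_one) G.fps_nonneg

lemma relayArrivalProb_le_one : G.relayArrivalProb ≤ 1 := by
  have h1 := G.fp_pos
  have h2 := G.fps_le_one
  have h3 := G.fps_nonneg
  have h4 := G.fp_le_one
  unfold relayArrivalProb
  nlinarith

lemma μp_eq : G.μp = G.fp + G.relayArrivalProb := rfl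

lemma μp_pos : 0 < G.μp := add_pos_of_pos_of_nonneg G.fp_pos G.relayArrivalProb_nonneg

/-! ### One slot of the queue dynamics: balance equations and monotonicity -/

section Step

variable {G}

/-- A departure requires a nonempty queue, so the truncated subtraction is an honest one and the
balance can be written in ℝ. -/
lemma step_fst (x : Slot G.N) (q : ℕ × ℕ) : ((G.step x q).1 : ℝ) =
    q.1 - ind (0 < q.1) * ind (G.DirectOK x ∨ G.OverheardOK x) + ind (x.arrival = true) := by
  rw [← ind_and]
  rcases q with ⟨_ | q1, q2⟩ <;> by_cases hA : x.arrival = true <;>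
    by_cases hL : G.DirectOK x ∨ G.OverheardOK x <;> simp [step, hA, hL]

lemma step_snd (x : Slot G.N) (q : ℕ × ℕ) : ((G.step x q).2 : ℝ) =
    q.2 - ind (q.1 = 0 ∧ 0 < q.2) * ind (G.RelayOK (G.jointAllocation x) x) +
      ind (0 < q.1) * ind (¬ G.DirectOK x ∧ G.OverheardOK x) := by
  rw [← ind_and, ← ind_and]
  rcases q with ⟨_ | q1, _ | q2⟩ <;> by_cases hR : G.RelayOK (G.jointAllocation x) x <;>
    by_cases hO : ¬ G.DirectOK x ∧ G.OverheardOK x <;> simp [step, allocation, hR, hO]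

/-- Arrivals to the smaller state are arrivals to the larger one. A departure that only the larger
state has occurs in a queue that is empty in the smaller state, hence strictly longer in the larger
one. For the relay queue note that service in the larger state requires its PU queue, and so the
smaller one, to be empty. -/
lemma step_mono (x : Slot G.N) {q q' : ℕ × ℕ} (h : q ≤ q') : G.step x q ≤ G.step x q' := by
  obtain ⟨h1, h2⟩ := h
  rcases q with ⟨q1, q2⟩
  rcases q' with ⟨q1', q2'⟩
  dsimp only at h1 h2
  constructor
  · by_cases hL : G.DirectOK x ∨ G.OverheardOK x <;> simp only [step, hL, and_true, and_false] <;>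
      split_ifs <;> omega
  · rcases q2 with _ | q2 <;> rcases q2' with _ | q2' <;>
      by_cases hR : G.RelayOK (G.jointAllocation x) x <;>
      by_cases hO : ¬ G.DirectOK x ∧ G.OverheardOK x <;>
      simp only [step, allocation, hR, hO, if_pos, if_neg, Nat.succ_ne_zero, lt_irrefl,
        Nat.succ_pos, and_true, and_false, false_and, not_false_eq_true] <;>
      (try split_ifs) <;> omega

variable (G) in
lemma measurable_step : Measurable fun p : Slot G.N × (ℕ × ℕ) => G.step p.1 p.2 := by
  refine measurable_from_prod_countable_left fun q => ?_
  have hL : MeasurableSet {x : Slot G.N | G.DirectOK x ∨ G.OverheardOK x} :=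
    G.measurableSet_directOK.union G.measurableSet_overheardOK
  have hO : MeasurableSet {x : Slot G.N | ¬ G.DirectOK x ∧ G.OverheardOK x} :=
    G.measurableSet_directOK.compl.inter G.measurableSet_overheardOK
  have hA : MeasurableSet {x : Slot G.N | x.arrival = true} :=
    Slot.measurable_arrival (measurableSet_singleton true)
  have hR : MeasurableSet {x : Slot G.N | q.1 = 0 ∧ 0 < q.2 ∧
      G.RelayOK (G.allocation q.2 x) x} := by
    have : {x : Slot G.N | q.1 = 0 ∧ 0 < q.2 ∧ G.RelayOK (G.allocation q.2 x) x} =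
        {_x | q.1 = 0 ∧ 0 < q.2} ∩ {x | G.RelayOK (G.jointAllocation x) x} := by
      ext x
      by_cases h : q.2 = 0 <;> simp [h, allocation, and_assoc]
    rw [this]
    exact (MeasurableSet.const _).inter G.measurableSet_relayOK
  change Measurable fun x => G.step x q
  unfold step
  refine Measurable.prodMk ?_ ?_
  · refine Measurable.add (Measurable.sub measurable_const ?_) ?_
    · exact Measurable.ite ((MeasurableSet.const (0 < q.1)).inter hL) measurable_const
        measurable_const
    · exact Measurable.ite hA measurable_const measurable_const
  · refine Measurable.add (Measurable.sub measurable_const ?_) ?_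
    · exact Measurable.ite hR measurable_const measurable_const
    · exact Measurable.ite ((MeasurableSet.const (0 < q.1)).inter hO) measurable_const
        measurable_const

end Step

/-- The state at the start of slot n involves slots before n only; hence it is independent of slot
n. -/
lemma measurable_past_queue (q₀ : ℕ × ℕ) (n : ℕ) :
    Measurable[past (Slot G.N) n] fun ω => G.queue q₀ ω n := by
  induction n with
  | zero => exact measurable_const
  | succ n ih =>
    have h : Measurable[past (Slot G.N) (n + 1)] fun ω : ℕ → Slot G.N => (ω n, G.queue q₀ ω n) :=
      (measurable_past_eval n.lt_succ_self).prodMk (ih.mono (past_mono n.le_succ) le_rfl)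
    exact G.measurable_step.comp h

lemma measurable_queue (q₀ : ℕ × ℕ) (n : ℕ) : Measurable fun ω => G.queue q₀ ω n :=
  (G.measurable_past_queue q₀ n).mono (past_le n) le_rfl

lemma measurableSet_queue (q₀ : ℕ × ℕ) (n : ℕ) (A : Set (ℕ × ℕ)) :
    MeasurableSet {ω | G.queue q₀ ω n ∈ A} :=
  G.measurable_queue q₀ n (.of_discrete)

lemma queue_mono {q q' : ℕ × ℕ} (h : q ≤ q') (ω : ℕ → Slot G.N) (n : ℕ) :
    G.queue q ω n ≤ G.queue q' ω n := by
  induction n with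
  | zero => exact h
  | succ n ih => exact step_mono _ ih

/-- Two trajectories driven by the same randomness stay together once the larger one has
emptied. -/
lemma queue_eq_of_hit (q₀ : ℕ × ℕ) (ω : ℕ → Slot G.N) {k n : ℕ} (hkn : k ≤ n)
    (hk : G.queue q₀ ω k = 0) : G.queue q₀ ω n = G.queue 0 ω n := by
  induction n, hkn using Nat.le_induction with
  | base =>
    have h := G.queue_mono (q := 0) (q' := q₀) zero_le ω k
    rw [hk] at h ⊢
    exact le_antisymm zero_le h
  | succ n _ ih => exact congrArg (G.step (ω n)) ih

/-! ### Stochastic monotonicity and coupling with the empty start -/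

section Coupling

variable (lam : unitInterval)

/-- The transition operator of the pair of queues. -/
def transition (g : ℕ × ℕ → ENNReal) (q : ℕ × ℕ) : ENNReal := ∫⁻ x, g (G.step x q) ∂G.slotLaw lam

variable {G lam} in
lemma transition_antitone {g : ℕ × ℕ → ENNReal} (hg : Antitone g) :
    Antitone (G.transition lam g) := fun _ _ h =>
  lintegral_mono fun x => hg (step_mono x h)

/-- The Markov property. The extra past variable `Y` allows the indicator that the queues have not
yet emptied to be carried along. -/
lemma lintegral_queue_succ {β : Type*} [MeasurableSpace β] (q₀ : ℕ × ℕ) {n : ℕ}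
    {Y : (ℕ → Slot G.N) → β} (hY : Measurable[past (Slot G.N) n] Y)
    {f : β × (ℕ × ℕ) → ENNReal} (hf : Measurable f) :
    ∫⁻ ω, f (Y ω, G.queue q₀ ω (n + 1)) ∂G.law lam =
      ∫⁻ ω, ∫⁻ x, f (Y ω, G.step x (G.queue q₀ ω n)) ∂G.slotLaw lam ∂G.law lam := by
  have hm : Measurable fun p : (β × (ℕ × ℕ)) × Slot G.N => f (p.1.1, G.step p.2 p.1.2) :=
    hf.comp ((measurable_fst.comp measurable_fst).prodMk
      (G.measurable_step.comp (measurable_snd.prodMk (measurable_snd.comp measurable_fst))))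
  exact lintegral_past (G.slotLaw lam) (hY.prodMk (G.measurable_past_queue q₀ n)) hm

/-- Peeling off the last slot makes the law at time n a function of the initial state, so that
different initial states can be compared. -/
lemma lintegral_queue_eq_transition_iterate (q₀ : ℕ × ℕ) (n : ℕ) (g : ℕ × ℕ → ENNReal) :
    ∫⁻ ω, g (G.queue q₀ ω n) ∂G.law lam = (G.transition lam)^[n] g q₀ := by
  induction n generalizing g with
  | zero => simp [queue]
  | succ n ih =>
    rw [Function.iterate_succ_apply, ← ih (G.transition lam g)]
    exact G.lintegral_queue_succ lam q₀ (Y := fun _ => ()) measurable_const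
      (f := fun p => g p.2) ((Measurable.of_discrete (f := g)).comp measurable_snd)

/-- Started empty, the queues grow stochastically. -/
lemma law_queue_zero_antitone {D : Set (ℕ × ℕ)} (hD : IsLowerSet D) :
    Antitone fun n => (G.law lam).real {ω | G.queue 0 ω n ∈ D} := by
  set g : ℕ × ℕ → ENNReal := D.indicator 1
  have hg : Antitone g := fun q q' h => by
    by_cases hq' : q' ∈ D
    · simp [g, hq', hD h hq']
    · simp [g, hq']
  have key : ∀ n, (G.law lam) {ω | G.queue 0 ω n ∈ D} = (G.transition lam)^[n] g 0 := fun n => by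
    rw [← G.lintegral_queue_eq_transition_iterate lam 0 n g,
      ← lintegral_indicator_one (G.measurableSet_queue 0 n D)]
    rfl
  have hit : ∀ n, Antitone ((G.transition lam)^[n] g) := fun n => by
    induction n with
    | zero => exact hg
    | succ n ih => rw [Function.iterate_succ_apply']; exact transition_antitone ih
  refine antitone_nat_of_succ_le fun n => ?_
  refine ENNReal.toReal_mono (measure_ne_top _ _) ?_
  rw [key, key, Function.iterate_succ_apply']
  -- The iterate is antitone and the empty state is the least one, so one preliminary slot from it
  -- can only lower the value.
  calc G.transition lam ((G.transition lam)^[n] g) 0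
      ≤ ∫⁻ _, (G.transition lam)^[n] g 0 ∂G.slotLaw lam :=
        lintegral_mono fun x => hit n zero_le
    _ = _ := by simp

/-- The coupling inequality: both trajectories are driven by the same slots and can differ at time n
only if the one from `q₀` has not been empty before. -/
lemma abs_law_queue_sub_le (q₀ : ℕ × ℕ) (n : ℕ) (D : Set (ℕ × ℕ)) :
    |(G.law lam).real {ω | G.queue q₀ ω n ∈ D} - (G.law lam).real {ω | G.queue 0 ω n ∈ D}| ≤
      (G.law lam).real {ω | ∀ k ≤ n, G.queue q₀ ω k ≠ 0} := by
  have h : ∀ ω, ω ∉ {ω | ∀ k ≤ n, G.queue q₀ ω k ≠ 0} →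
      G.queue q₀ ω n = G.queue 0 ω n := fun ω hω => by
    simp only [Set.mem_ofPred_eq, not_forall, not_not] at hω
    obtain ⟨k, hk, hk0⟩ := hω
    exact G.queue_eq_of_hit q₀ ω hk hk0
  have key : ∀ A B T : Set (ℕ → Slot G.N), A ⊆ B ∪ T →
      (G.law lam).real A ≤ (G.law lam).real B + (G.law lam).real T := fun A B T hABT =>
    (measureReal_mono hABT).trans (measureReal_union_le _ _)
  rw [abs_sub_le_iff]
  constructor
  · rw [sub_le_iff_le_add']
    refine key _ _ _ fun ω hω => ?_
    by_cases hT : ω ∈ {ω | ∀ k ≤ n, G.queue q₀ ω k ≠ 0}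
    · exact Or.inr hT
    · left
      change G.queue 0 ω n ∈ D
      rw [← h ω hT]
      exact hω
  · rw [sub_le_iff_le_add']
    refine key _ _ _ fun ω hω => ?_
    by_cases hT : ω ∈ {ω | ∀ k ≤ n, G.queue q₀ ω k ≠ 0}
    · exact Or.inr hT
    · left
      change G.queue q₀ ω n ∈ D
      rw [h ω hT]
      exact hω

/-- If the queues empty almost surely, then the probabilities of lower sets converge. -/
lemma exists_tendsto_law_queue {q₀ : ℕ × ℕ}
    (hhit : Tendsto (fun n => (G.law lam).real {ω | ∀ k ≤ n, G.queue q₀ ω k ≠ 0}) atTop (𝓝 0))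
    {D : Set (ℕ × ℕ)} (hD : IsLowerSet D) :
    ∃ ℓ, Tendsto (fun n => (G.law lam).real {ω | G.queue q₀ ω n ∈ D}) atTop (𝓝 ℓ) := by
  have h0 := tendsto_atTop_ciInf (G.law_queue_zero_antitone lam hD)
    ⟨0, by rintro _ ⟨n, rfl⟩; exact measureReal_nonneg⟩
  have h1 : Tendsto (fun n => (G.law lam).real {ω | G.queue q₀ ω n ∈ D} -
      (G.law lam).real {ω | G.queue 0 ω n ∈ D}) atTop (𝓝 0) :=
    squeeze_zero_norm (fun n => G.abs_law_queue_sub_le lam q₀ n D) hhit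
  exact ⟨_, by simpa using h1.add h0⟩

end Coupling

/-! ### Drift, Lyapunov function and exponential tails -/

section Drift

/-- A linear function of the queue lengths. -/
def weight (a b : ℝ) (q : ℕ × ℕ) : ℝ := a * q.1 + b * q.2

/-- The increment of `weight a b` in one slot. -/
def increment (a b : ℝ) (q : ℕ × ℕ) (x : Slot G.N) : ℝ :=
  a * (ind (x.arrival = true) - ind (0 < q.1) * ind (G.DirectOK x ∨ G.OverheardOK x)) +
    b * (ind (0 < q.1) * ind (¬ G.DirectOK x ∧ G.OverheardOK x) -
      ind (q.1 = 0 ∧ 0 < q.2) * ind (G.RelayOK (G.jointAllocation x) x))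

variable {G}

lemma weight_step (a b : ℝ) (q : ℕ × ℕ) (x : Slot G.N) :
    weight a b (G.step x q) = weight a b q + G.increment a b q x := by
  unfold weight increment
  rw [step_fst, step_snd]
  ring

lemma weight_nonneg {a b : ℝ} (ha : 0 ≤ a) (hb : 0 ≤ b) (q : ℕ × ℕ) : 0 ≤ weight a b q := by
  unfold weight; positivity

lemma abs_increment_le {a b : ℝ} (ha : 0 ≤ a) (hb : 0 ≤ b) (q : ℕ × ℕ) (x : Slot G.N) :
    |G.increment a b q x| ≤ a + b := by
  have h1 : |ind (x.arrival = true) - ind (0 < q.1) * ind (G.DirectOK x ∨ G.OverheardOK x)| ≤ 1 := by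
    rw [← ind_and]
    exact abs_sub_le_of_nonneg_of_le (ind_nonneg _) (ind_le_one _) (ind_nonneg _) (ind_le_one _)
  have h2 : |ind (0 < q.1) * ind (¬ G.DirectOK x ∧ G.OverheardOK x) -
      ind (q.1 = 0 ∧ 0 < q.2) * ind (G.RelayOK (G.jointAllocation x) x)| ≤ 1 := by
    rw [← ind_and, ← ind_and]
    exact abs_sub_le_of_nonneg_of_le (ind_nonneg _) (ind_le_one _) (ind_nonneg _) (ind_le_one _)
  unfold increment
  refine (abs_add_le _ _).trans ?_
  rw [abs_mul, abs_mul, abs_of_nonneg ha, abs_of_nonneg hb]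
  nlinarith

variable (G)

lemma measurableSet_arrival : MeasurableSet {x : Slot G.N | x.arrival = true} :=
  Slot.measurable_arrival (measurableSet_singleton true)

lemma measurableSet_leaves : MeasurableSet {x : Slot G.N | G.DirectOK x ∨ G.OverheardOK x} :=
  G.measurableSet_directOK.union G.measurableSet_overheardOK

lemma measurableSet_overheard_not_direct :
    MeasurableSet {x : Slot G.N | ¬ G.DirectOK x ∧ G.OverheardOK x} :=
  G.measurableSet_directOK.compl.inter G.measurableSet_overheardOK

lemma measurable_increment (a b : ℝ) (q : ℕ × ℕ) : Measurable (G.increment a b q) :=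
  (((measurable_ind G.measurableSet_arrival).sub
    ((measurable_ind G.measurableSet_leaves).const_mul _)).const_mul a).add
    ((((measurable_ind G.measurableSet_overheard_not_direct).const_mul _).sub
    ((measurable_ind G.measurableSet_relayOK).const_mul _)).const_mul b)

lemma integral_increment (lam : unitInterval) (a b : ℝ) (q : ℕ × ℕ) :
    ∫ x, G.increment a b q x ∂G.slotLaw lam = a * (lam - ind (0 < q.1) * G.μp) +
      b * (ind (0 < q.1) * G.relayArrivalProb - ind (q.1 = 0 ∧ 0 < q.2) * G.fr) := by
  have iA := integrable_ind (μ := G.slotLaw lam) G.measurableSet_arrival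
  have iL := (integrable_ind (μ := G.slotLaw lam) G.measurableSet_leaves).const_mul (ind (0 < q.1))
  have iO := (integrable_ind (μ := G.slotLaw lam) G.measurableSet_overheard_not_direct).const_mul
    (ind (0 < q.1))
  have iR := (integrable_ind (μ := G.slotLaw lam) G.measurableSet_relayOK).const_mul
    (ind (q.1 = 0 ∧ 0 < q.2))
  have e : ∫ x, G.increment a b q x ∂G.slotLaw lam =
      a * (∫ x, ind (x.arrival = true) ∂G.slotLaw lam -
        ∫ x, ind (0 < q.1) * ind (G.DirectOK x ∨ G.OverheardOK x) ∂G.slotLaw lam) +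
      b * (∫ x, ind (0 < q.1) * ind (¬ G.DirectOK x ∧ G.OverheardOK x) ∂G.slotLaw lam -
        ∫ x, ind (q.1 = 0 ∧ 0 < q.2) * ind (G.RelayOK (G.jointAllocation x) x) ∂G.slotLaw lam) := by
    rw [← integral_sub iA iL, ← integral_sub iO iR, ← integral_const_mul, ← integral_const_mul]
    exact integral_add ((iA.sub iL).const_mul a) ((iO.sub iR).const_mul b)
  rw [e, integral_const_mul, integral_const_mul, integral_const_mul, integral_ind G.measurableSet_arrival,
    integral_ind G.measurableSet_leaves, integral_ind G.measurableSet_overheard_not_direct,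
    integral_ind G.measurableSet_relayOK, slotLaw_arrival, slotLaw_leaves,
    slotLaw_overheard_not_direct, slotLaw_relayOK, relayArrivalProb]

/-- With weights fr and lam the drift is 0 when only the relay queue is nonempty and -δ when the PU
is busy. Raising the second weight by δ / 2 makes the former -δ fr / 2 and the latter at most -δ /
2, because ρ ≤ 1. -/
lemma exists_negative_drift {lam : unitInterval}
    (h : (lam : ℝ) * (G.fr + G.relayArrivalProb) < G.fr * G.μp) :
    ∃ a b ε : ℝ, 0 < a ∧ 0 < b ∧ 0 < ε ∧
      ∀ q : ℕ × ℕ, q ≠ 0 → ∫ x, G.increment a b q x ∂G.slotLaw lam ≤ -ε := by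
  have hfr := G.fr_pos
  have hlam : (0 : ℝ) ≤ lam := lam.2.1
  have h1 := G.relayArrivalProb_le_one
  set δ := G.fr * G.μp - lam * (G.fr + G.relayArrivalProb) with hδ
  have hδ0 : 0 < δ := by linarith
  refine ⟨G.fr, lam + δ / 2, min (δ / 2) (δ / 2 * G.fr), hfr, by positivity, by positivity,
    fun q hq => ?_⟩
  rw [integral_increment]
  rcases q with ⟨_ | q1, q2⟩
  · have h2 : 0 < q2 := Nat.pos_of_ne_zero fun h0 => hq (by rw [h0]; rfl)
    have := min_le_right (δ / 2) (δ / 2 * G.fr)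
    simp [h2]
    linarith
  · have := min_le_left (δ / 2) (δ / 2 * G.fr)
    simp
    nlinarith

/-- In the stable regime an exponential of a linear function is a Lyapunov function. -/
lemma exists_lyapunov {lam : unitInterval}
    (h : (lam : ℝ) * (G.fr + G.relayArrivalProb) < G.fr * G.μp) :
    ∃ a b θ r C : ℝ, 0 < a ∧ 0 < b ∧ 0 < θ ∧ 0 < r ∧ r < 1 ∧ 0 ≤ C ∧ ∀ q : ℕ × ℕ,
      (∫⁻ x, ENNReal.ofReal (Real.exp (θ * weight a b (G.step x q))) ∂G.slotLaw lam ≤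
        ENNReal.ofReal (C + r * Real.exp (θ * weight a b q))) ∧
      (q ≠ 0 → ∫⁻ x, ENNReal.ofReal (Real.exp (θ * weight a b (G.step x q))) ∂G.slotLaw lam ≤
        ENNReal.ofReal (r * Real.exp (θ * weight a b q))) := by
  obtain ⟨a, b, ε, ha, hb, hε, hdrift⟩ := G.exists_negative_drift h
  set c := a + b with hc
  have hc0 : 0 < c := by positivity
  -- The first bound makes the quadratic estimate of the exponential valid. The second gives (θ c)²
  -- ≤ θ ε / 2, so the factor 1 - θ ε + (θ c)² is at most 1 - θ ε / 2 ≤ exp (-(θ ε / 2)).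
  set θ := min (1 / c) (ε / (2 * c ^ 2)) with hθ
  have hθ0 : 0 < θ := by positivity
  have hθ1 : θ * c ≤ 1 := (le_div_iff₀ hc0).1 (min_le_left _ _)
  have hθ2 : θ * (2 * c ^ 2) ≤ ε := (le_div_iff₀ (by positivity)).1 (min_le_right _ _)
  have hne : ∀ q : ℕ × ℕ, q ≠ 0 →
      ∫⁻ x, ENNReal.ofReal (Real.exp (θ * weight a b (G.step x q))) ∂G.slotLaw lam ≤
        ENNReal.ofReal (Real.exp (-(θ * ε / 2)) * Real.exp (θ * weight a b q)) := fun q hq => by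
    simp_rw [weight_step, mul_add, Real.exp_add, ENNReal.ofReal_mul (Real.exp_pos _).le]
    have hm := G.measurable_increment a b q
    rw [lintegral_const_mul _ (by fun_prop), mul_comm]
    gcongr
    refine (lintegral_exp_le hm (c := c) (abs_increment_le ha.le hb.le q) (hdrift q hq) hθ0.le
      hθ1).trans (ENNReal.ofReal_le_ofReal ?_)
    have h1 := Real.add_one_le_exp (-(θ * ε / 2))
    nlinarith
  refine ⟨a, b, θ, Real.exp (-(θ * ε / 2)), Real.exp 1, ha, hb, hθ0, Real.exp_pos _, ?_,
    (Real.exp_pos _).le, fun q => ⟨?_, hne q⟩⟩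
  · rw [Real.exp_lt_one_iff]
    have : 0 < θ * ε := by positivity
    linarith
  -- From the empty state the drift may be positive, but one increment is at most c and θ c ≤ 1,
  -- whence the constant exp 1.
  · by_cases hq : q = 0
    · calc ∫⁻ x, ENNReal.ofReal (Real.exp (θ * weight a b (G.step x q))) ∂G.slotLaw lam
          ≤ ∫⁻ _, ENNReal.ofReal (Real.exp 1) ∂G.slotLaw lam := by
            refine lintegral_mono fun x => ENNReal.ofReal_le_ofReal (Real.exp_le_exp.2 ?_)
            have h1 := (abs_le.1 (abs_increment_le ha.le hb.le q x)).2
            have h2 : weight a b q = 0 := by simp [hq, weight]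
            rw [weight_step, h2, zero_add]
            nlinarith
        _ = ENNReal.ofReal (Real.exp 1) := by simp
        _ ≤ _ := ENNReal.ofReal_le_ofReal (le_add_of_nonneg_right (by positivity))
    · exact (hne q hq).trans
        (ENNReal.ofReal_le_ofReal (le_add_of_nonneg_left (Real.exp_pos _).le))

/-- In the stable regime the queue lengths have exponential tails, uniformly in time, and both
queues empty in geometrically distributed time. -/
theorem exists_exponential_tails {lam : unitInterval}
    (h : (lam : ℝ) * (G.fr + G.relayArrivalProb) < G.fr * G.μp) (q₀ : ℕ × ℕ) :
    ∃ a b θ K r : ℝ, 0 < a ∧ 0 < b ∧ 0 < θ ∧ 0 ≤ K ∧ 0 < r ∧ r < 1 ∧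
      (∀ n t, (G.law lam) {ω | t ≤ weight a b (G.queue q₀ ω n)} ≤
        ENNReal.ofReal (K * Real.exp (-(θ * t)))) ∧
      ∀ n, (G.law lam) {ω | ∀ k ≤ n, G.queue q₀ ω k ≠ 0} ≤ ENNReal.ofReal (K * r ^ n) := by
  obtain ⟨a, b, θ, r, C, ha, hb, hθ, hr0, hr1, hC, hlyap⟩ := G.exists_lyapunov h
  set f : ℕ × ℕ → ENNReal := fun q => ENNReal.ofReal (Real.exp (θ * weight a b q)) with hf
  have hfm : ∀ n, Measurable fun ω => f (G.queue q₀ ω n) := fun n =>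
    (Measurable.of_discrete (f := f)).comp (G.measurable_queue q₀ n)
  -- C / (1 - r) is the fixed point of m ↦ C + r m; hence any K above it satisfies C + r K ≤ K, and
  -- this one also dominates the initial value.
  set K := Real.exp (θ * weight a b q₀) + C / (1 - r) with hK
  have h1r : 0 < 1 - r := by linarith
  have hCr : 0 ≤ C / (1 - r) := by positivity
  have hK0 : Real.exp (θ * weight a b q₀) ≤ K := le_add_of_nonneg_right hCr
  have hKpos : 0 ≤ K := (Real.exp_pos _).le.trans hK0
  have hKstep : C + r * K ≤ K := by
    have h2 : C / (1 - r) * (1 - r) = C := div_mul_cancel₀ _ h1r.ne'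
    have h3 := mul_pos h1r (Real.exp_pos (θ * weight a b q₀))
    rw [hK]
    nlinarith
  have hmom : ∀ n, ∫⁻ ω, f (G.queue q₀ ω n) ∂G.law lam ≤ ENNReal.ofReal K := fun n => by
    induction n with
    | zero => simpa [queue, hf] using ENNReal.ofReal_le_ofReal hK0
    | succ n ih =>
      have e := G.lintegral_queue_succ lam q₀ (n := n) (Y := fun _ => ()) measurable_const
        (f := fun p => f p.2) ((Measurable.of_discrete (f := f)).comp measurable_snd)
      dsimp only at e
      rw [e]
      calc ∫⁻ ω, ∫⁻ x, f (G.step x (G.queue q₀ ω n)) ∂G.slotLaw lam ∂G.law lam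
          ≤ ∫⁻ ω, (ENNReal.ofReal C + ENNReal.ofReal r * f (G.queue q₀ ω n)) ∂G.law lam := by
            refine lintegral_mono fun ω => ((hlyap _).1).trans_eq ?_
            rw [ENNReal.ofReal_add hC (by positivity), ENNReal.ofReal_mul hr0.le]
        _ = ENNReal.ofReal C + ENNReal.ofReal r * ∫⁻ ω, f (G.queue q₀ ω n) ∂G.law lam := by
            rw [lintegral_add_left measurable_const, lintegral_const_mul _ (hfm n)]
            simp
        _ ≤ ENNReal.ofReal C + ENNReal.ofReal r * ENNReal.ofReal K := by gcongr
        _ = ENNReal.ofReal (C + r * K) := by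
            rw [ENNReal.ofReal_add hC (by positivity), ENNReal.ofReal_mul hr0.le]
        _ ≤ _ := ENNReal.ofReal_le_ofReal hKstep
  refine ⟨a, b, θ, K, r, ha, hb, hθ, hKpos, hr0, hr1, fun n t => ?_, fun n => ?_⟩
  · exact measure_ge_le_of_lintegral_exp_le
      ((Measurable.of_discrete (f := weight a b)).comp (G.measurable_queue q₀ n)) hθ.le (hmom n)
  set T : ℕ → Set (ℕ → Slot G.N) := fun n => {ω | ∀ k ≤ n, G.queue q₀ ω k ≠ 0} with hT
  have hTm : ∀ n, MeasurableSet[past (Slot G.N) n] (T n) := fun n => by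
    have : T n = ⋂ k ∈ Set.Iic n, {ω | G.queue q₀ ω k ∈ ({0}ᶜ : Set (ℕ × ℕ))} := by
      ext ω; simp [T]
    rw [this]
    refine MeasurableSet.biInter (Set.to_countable _) fun k hk => ?_
    exact ((G.measurable_past_queue q₀ k).mono (past_mono hk) le_rfl) (.of_discrete)
  -- Until the queues first empty, the mean of f shrinks by the factor r in each slot. As f ≥ 1,
  -- this bounds the probability of no emptying.
  have hu : ∀ n, ∫⁻ ω, (T n).indicator 1 ω * f (G.queue q₀ ω n) ∂G.law lam ≤
      ENNReal.ofReal (K * r ^ n) := fun n => by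
    induction n with
    | zero =>
      refine (lintegral_mono fun ω => ?_).trans ((hmom 0).trans_eq (by simp))
      exact mul_le_of_le_one_left (by simp) (Set.indicator_le_self' (by simp) ω)
    | succ n ih =>
      have hY : Measurable[past (Slot G.N) n] ((T n).indicator (1 : (ℕ → Slot G.N) → ENNReal)) :=
        Measurable.indicator measurable_const (hTm n)
      have hfm2 : Measurable fun p : ENNReal × (ℕ × ℕ) => p.1 * f p.2 :=
        measurable_fst.mul ((Measurable.of_discrete (f := f)).comp measurable_snd)
      have e := G.lintegral_queue_succ lam q₀ (n := n) hY hfm2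
      dsimp only at e
      calc ∫⁻ ω, (T (n + 1)).indicator 1 ω * f (G.queue q₀ ω (n + 1)) ∂G.law lam
          ≤ ∫⁻ ω, (T n).indicator 1 ω * f (G.queue q₀ ω (n + 1)) ∂G.law lam := by
            refine lintegral_mono fun ω => ?_
            -- Passing to the larger event makes the indicator measurable with respect to the past
            -- of slot n.
            have hsub : T (n + 1) ⊆ T n := fun ω' hω' k hk => hω' k (hk.trans n.le_succ)
            exact mul_le_mul_left (Set.indicator_le_indicator_of_subset hsub
              (fun _ => zero_le) ω) _
        _ = _ := e
        _ ≤ ∫⁻ ω, ENNReal.ofReal r * ((T n).indicator 1 ω * f (G.queue q₀ ω n)) ∂G.law lam := by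
            refine lintegral_mono fun ω => ?_
            rw [lintegral_const_mul' _ _ (by by_cases hω : ω ∈ T n <;> simp [hω])]
            by_cases hω : ω ∈ T n
            · simp only [hω, Set.indicator_of_mem, Pi.one_apply, one_mul]
              refine ((hlyap _).2 (hω n le_rfl)).trans_eq ?_
              rw [ENNReal.ofReal_mul hr0.le]
            · simp [hω]
        _ = ENNReal.ofReal r * ∫⁻ ω, (T n).indicator 1 ω * f (G.queue q₀ ω n) ∂G.law lam :=
            lintegral_const_mul' _ _ ENNReal.ofReal_ne_top
        _ ≤ ENNReal.ofReal r * ENNReal.ofReal (K * r ^ n) := by gcongr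
        _ = _ := by rw [← ENNReal.ofReal_mul hr0.le]; ring_nf
  refine le_trans ?_ (hu n)
  rw [← lintegral_indicator_one (past_le n _ (hTm n))]
  refine lintegral_mono fun ω => ?_
  refine le_mul_of_one_le_right (by simp) ?_
  rw [hf, ENNReal.one_le_ofReal, Real.one_le_exp_iff]
  exact mul_nonneg hθ.le (weight_nonneg ha.le hb.le _)

end Drift

/-! ### Long-run frequencies and throughputs in the stable regime -/

section Rates

variable (q₀ : ℕ × ℕ)

/-- Strong law of large numbers for events that combine the queue state at the beginning of a slot
with the randomness of that slot. -/
lemma ae_sum_ind_tendsto_zero (lam : unitInterval) (p : ℕ × ℕ → Prop) {B : Slot G.N → Prop}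
    (hB : MeasurableSet {x | B x}) :
    ∀ᵐ ω ∂G.law lam, Tendsto (fun n : ℕ => (∑ k ∈ Finset.range n,
      ind (p (G.queue q₀ ω k)) * (ind (B (ω k)) - (G.slotLaw lam).real {x | B x})) / n)
      atTop (𝓝 0) := by
  refine ae_weighted_average_tendsto_zero (ν := G.slotLaw lam)
    (H := fun k ω => ind (p (G.queue q₀ ω k)))
    (η := fun x => ind (B x) - (G.slotLaw lam).real {x | B x})
    (fun k => (Measurable.of_discrete (f := fun q => ind (p q))).comp
      (G.measurable_past_queue q₀ k)) (fun k ω => ?_)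
    ((measurable_ind hB).sub_const _) (fun x => ?_) ?_
  · rw [abs_of_nonneg (ind_nonneg _)]; exact ind_le_one _
  · exact abs_sub_le_of_nonneg_of_le (ind_nonneg _) (ind_le_one _) measureReal_nonneg
      measureReal_le_one
  · rw [integral_sub (integrable_ind hB) (integrable_const _), integral_ind hB]
    simp

lemma sum_ind_mul_sub (s : ℕ → ℝ) (t : ℕ → ℝ) (c : ℝ) (n : ℕ) :
    (∑ k ∈ Finset.range n, s k * (t k - c)) / n =
      (∑ k ∈ Finset.range n, s k * t k) / n - c * ((∑ k ∈ Finset.range n, s k) / n) := by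
  simp only [mul_sub, Finset.sum_sub_distrib, ← Finset.sum_mul]
  ring

/-- The rate of a combined event is the product of the frequency of the queue event and the
probability of the slot event. -/
lemma ae_rate_of_frequency (lam : unitInterval) (p : ℕ × ℕ → Prop) {B : Slot G.N → Prop}
    (hB : MeasurableSet {x | B x}) :
    ∀ᵐ ω ∂G.law lam, ∀ c, Tendsto (fun n : ℕ => (∑ k ∈ Finset.range n,
      ind (p (G.queue q₀ ω k))) / n) atTop (𝓝 c) →
      Tendsto (fun n : ℕ => (∑ k ∈ Finset.range n,
      ind (p (G.queue q₀ ω k)) * ind (B (ω k))) / n) atTop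
        (𝓝 (c * (G.slotLaw lam).real {x | B x})) := by
  filter_upwards [G.ae_sum_ind_tendsto_zero q₀ lam p hB] with ω h c hc
  have := h.add (hc.const_mul ((G.slotLaw lam).real {x | B x}))
  simp only [sum_ind_mul_sub] at this
  convert this using 2 <;> ring

/-- Converse of `ae_rate_of_frequency`. -/
lemma ae_frequency_of_rate (lam : unitInterval) (p : ℕ × ℕ → Prop) {B : Slot G.N → Prop}
    (hB : MeasurableSet {x | B x}) (hB0 : (G.slotLaw lam).real {x | B x} ≠ 0) :
    ∀ᵐ ω ∂G.law lam, ∀ c, Tendsto (fun n : ℕ => (∑ k ∈ Finset.range n,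
      ind (p (G.queue q₀ ω k)) * ind (B (ω k))) / n) atTop (𝓝 c) →
      Tendsto (fun n : ℕ => (∑ k ∈ Finset.range n,
      ind (p (G.queue q₀ ω k))) / n) atTop (𝓝 (c / (G.slotLaw lam).real {x | B x})) := by
  filter_upwards [G.ae_sum_ind_tendsto_zero q₀ lam p hB] with ω h c hc
  have := (hc.sub h).div_const ((G.slotLaw lam).real {x | B x})
  simp only [sum_ind_mul_sub] at this
  convert this using 2
  · field_simp; ring
  · ring

lemma queue_fst_eq_sum (ω : ℕ → Slot G.N) (n : ℕ) : ((G.queue q₀ ω n).1 : ℝ) =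
    q₀.1 + ∑ k ∈ Finset.range n, ind ((ω k).arrival = true) -
      ∑ k ∈ Finset.range n, ind (0 < (G.queue q₀ ω k).1) *
        ind (G.DirectOK (ω k) ∨ G.OverheardOK (ω k)) := by
  induction n with
  | zero => simp [queue]
  | succ n ih => rw [Finset.sum_range_succ, Finset.sum_range_succ, queue, step_fst, ih]; ring

lemma queue_snd_eq_sum (ω : ℕ → Slot G.N) (n : ℕ) : ((G.queue q₀ ω n).2 : ℝ) =
    q₀.2 + ∑ k ∈ Finset.range n, ind (0 < (G.queue q₀ ω k).1) *
        ind (¬ G.DirectOK (ω k) ∧ G.OverheardOK (ω k)) -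
      ∑ k ∈ Finset.range n, ind ((G.queue q₀ ω k).1 = 0 ∧ 0 < (G.queue q₀ ω k).2) *
        ind (G.RelayOK (G.jointAllocation (ω k)) (ω k)) := by
  induction n with
  | zero => simp [queue]
  | succ n ih => rw [Finset.sum_range_succ, Finset.sum_range_succ, queue, step_snd, ih]; ring

variable {lam : unitInterval} (h : (lam : ℝ) * (G.fr + G.relayArrivalProb) < G.fr * G.μp)

include h

/-- The tails at level ε n are summable in n, so Borel–Cantelli applies to the weight, which
dominates a positive multiple of each queue length. -/
lemma ae_queue_div_tendsto_zero : ∀ᵐ ω ∂G.law lam,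
    Tendsto (fun n : ℕ => ((G.queue q₀ ω n).1 : ℝ) / n) atTop (𝓝 0) ∧
      Tendsto (fun n : ℕ => ((G.queue q₀ ω n).2 : ℝ) / n) atTop (𝓝 0) := by
  obtain ⟨a, b, θ, K, -, ha, hb, hθ, hK, -, -, htail, -⟩ := G.exists_exponential_tails h q₀
  have hW := ae_eventually_lt_of_geometric (P := G.law lam)
    (X := fun n ω => weight a b (G.queue q₀ ω n)) fun ε hε =>
      ⟨K, Real.exp (-(θ * ε)), hK, (Real.exp_pos _).le,
        by rw [Real.exp_lt_one_iff]; have := mul_pos hθ hε; linarith, fun n => by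
          refine (htail n (ε * n)).trans_eq ?_
          rw [← Real.exp_nat_mul]
          ring_nf⟩
  filter_upwards [hW] with ω hω
  have hpos : ∀ x : ℕ → ℕ, ∀ ε > 0, ∀ᶠ n : ℕ in atTop, -(x n : ℝ) < ε * n := fun x ε hε => by
    filter_upwards [eventually_gt_atTop 0] with n hn
    have : (0 : ℝ) < ε * n := by positivity
    have h0 : (0 : ℝ) ≤ x n := (x n).cast_nonneg
    linarith
  refine ⟨tendsto_div_atTop_zero (fun ε hε => ?_) (hpos _),
    tendsto_div_atTop_zero (fun ε hε => ?_) (hpos _)⟩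
  · filter_upwards [hω (a * ε) (by positivity)] with n hn
    have : 0 ≤ b * (G.queue q₀ ω n).2 := by positivity
    unfold weight at hn
    nlinarith
  · filter_upwards [hω (b * ε) (by positivity)] with n hn
    have : 0 ≤ a * (G.queue q₀ ω n).1 := by positivity
    unfold weight at hn
    nlinarith

/-- Long-run frequencies of the three kinds of slots in the stable regime. -/
theorem ae_frequencies : ∀ᵐ ω ∂G.law lam,
    Tendsto (fun n : ℕ => (∑ k ∈ Finset.range n, ind (0 < (G.queue q₀ ω k).1)) / n) atTop
      (𝓝 (lam / G.μp)) ∧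
    Tendsto (fun n : ℕ => (∑ k ∈ Finset.range n,
      ind ((G.queue q₀ ω k).1 = 0 ∧ 0 < (G.queue q₀ ω k).2)) / n) atTop
      (𝓝 (lam / G.μp * G.relayArrivalProb / G.fr)) ∧
    Tendsto (fun n : ℕ => (∑ k ∈ Finset.range n,
      ind ((G.queue q₀ ω k).1 = 0 ∧ (G.queue q₀ ω k).2 = 0)) / n) atTop
      (𝓝 (1 - lam / G.μp - lam / G.μp * G.relayArrivalProb / G.fr)) := by
  have hone : Tendsto (fun n : ℕ => (n : ℝ) / n) atTop (𝓝 1) := by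
    refine tendsto_const_nhds.congr' ?_
    filter_upwards [eventually_gt_atTop 0] with n hn
    rw [div_self (by positivity)]
  have hL0 : (G.slotLaw lam).real {x | G.DirectOK x ∨ G.OverheardOK x} ≠ 0 := by
    rw [slotLaw_leaves]; exact G.μp_pos.ne'
  have hR0 : (G.slotLaw lam).real {x | G.RelayOK (G.jointAllocation x) x} ≠ 0 := by
    rw [slotLaw_relayOK]; exact G.fr_pos.ne'
  have hc : ∀ c : ℝ, Tendsto (fun n : ℕ => c / (n : ℝ)) atTop (𝓝 0) := fun c =>
    tendsto_const_nhds.div_atTop tendsto_natCast_atTop_atTop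
  filter_upwards [G.ae_queue_div_tendsto_zero q₀ h,
    G.ae_rate_of_frequency q₀ lam (fun _ => True) G.measurableSet_arrival,
    G.ae_frequency_of_rate q₀ lam (fun q => 0 < q.1) G.measurableSet_leaves hL0,
    G.ae_rate_of_frequency q₀ lam (fun q => 0 < q.1) G.measurableSet_overheard_not_direct,
    G.ae_frequency_of_rate q₀ lam (fun q => q.1 = 0 ∧ 0 < q.2) G.measurableSet_relayOK hR0]
    with ω hq hA hL hO hR
  rw [slotLaw_arrival] at hA
  rw [slotLaw_leaves] at hL
  rw [slotLaw_overheard_not_direct] at hO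
  rw [slotLaw_relayOK] at hR
  have hA' := hA 1 (by simpa using hone)
  simp only [ind_of_true, one_mul] at hA'
  -- Flow balance of the PU queue: departures are the initial length plus arrivals minus the present
  -- length, which is o(n). So departures have rate lam, and division by the service probability
  -- gives the busy frequency.
  have hbusy := hL lam (by
    have := ((hc q₀.1).add hA').sub hq.1
    simp only [queue_fst_eq_sum] at this
    convert this using 2 <;> ring)
  have hO' := hO _ hbusy
  -- The same balance for the relay queue, whose arrival rate is known from the busy frequency.
  have hrel := hR (lam / G.μp * G.relayArrivalProb) (by
    have := ((hc q₀.2).add hO').sub hq.2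
    simp only [queue_snd_eq_sum] at this
    convert this using 2
    · ring
    · rw [relayArrivalProb]; ring)
  refine ⟨hbusy, hrel, ((hone.sub hbusy).sub hrel).congr fun n => ?_⟩
  rw [← sub_div, ← sub_div]
  congr 1
  have e : ∀ k, ind ((G.queue q₀ ω k).1 = 0 ∧ (G.queue q₀ ω k).2 = 0) =
      1 - ind (0 < (G.queue q₀ ω k).1) -
        ind ((G.queue q₀ ω k).1 = 0 ∧ 0 < (G.queue q₀ ω k).2) := fun k => by
    rcases G.queue q₀ ω k with ⟨_ | q1, _ | q2⟩ <;> simp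
  simp [e]

/-- Direct deliveries have rate (lam / μp) fp and relayed ones (lam / μp) ρ; the sum is lam because
fp + ρ = μp. -/
theorem primaryThroughput_eq : G.PrimaryThroughput lam q₀ lam := by
  unfold PrimaryThroughput HasRate
  filter_upwards [G.ae_frequencies q₀ h,
    G.ae_rate_of_frequency q₀ lam (fun q => 0 < q.1) G.measurableSet_directOK,
    G.ae_rate_of_frequency q₀ lam (fun q => q.1 = 0 ∧ 0 < q.2) G.measurableSet_relayOK]
    with ω hf hD hR
  have h1 := (hD _ hf.1).add (hR _ hf.2.1)
  rw [slotLaw_directOK, slotLaw_relayOK] at h1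
  have h2 : (lam : ℝ) / G.μp * G.fp + lam / G.μp * G.relayArrivalProb / G.fr * G.fr = lam := by
    have := G.fr_pos.ne'
    have h3 := G.μp_pos.ne'
    rw [div_mul_cancel₀ _ this, ← mul_add, ← μp_eq, div_mul_cancel₀ _ h3]
  rw [h2] at h1
  refine h1.congr fun n => ?_
  rw [← add_div, ← Finset.sum_add_distrib]
  congr 1
  refine Finset.sum_congr rfl fun k _ => ?_
  change _ = ind (G.PrimaryDelivery q₀ k ω)
  rw [← ind_and, ← ind_and, ← ind_or (fun h => by omega)]
  congr 1
  refine propext ?_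
  unfold PrimaryDelivery allocation
  rcases G.queue q₀ ω k with ⟨_ | q1, _ | q2⟩ <;> simp

lemma secondaryThroughput_eq (i : Fin G.N) : G.SecondaryThroughput lam q₀ i
    (lam / G.μp * G.relayArrivalProb / G.fr * (1 / G.N * G.fsBusy) +
      (1 - lam / G.μp - lam / G.μp * G.relayArrivalProb / G.fr) * (1 / G.N * G.fsEmpty)) := by
  have hJ : MeasurableSet {x | (G.jointAllocation x).s = i ∧
      G.SecondaryOK (G.jointAllocation x) x} :=
    (G.measurable_jointAllocation.1 (measurableSet_singleton i)).inter
      (G.measurableSet_secondaryOK G.measurable_jointAllocation.1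
        G.measurable_jointAllocation.2.2.1)
  have hE : MeasurableSet {x | (G.aloneAllocation x).s = i ∧
      G.SecondaryOK (G.aloneAllocation x) x} :=
    (G.measurable_aloneAllocation_s (measurableSet_singleton i)).inter
      (G.measurableSet_secondaryOK G.measurable_aloneAllocation_s G.measurable_aloneAllocation_Ps)
  unfold SecondaryThroughput HasRate
  filter_upwards [G.ae_frequencies q₀ h,
    G.ae_rate_of_frequency q₀ lam (fun q => q.1 = 0 ∧ 0 < q.2) hJ,
    G.ae_rate_of_frequency q₀ lam (fun q => q.1 = 0 ∧ q.2 = 0) hE] with ω hf h1 h2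
  have h3 := (h1 _ hf.2.1).add (h2 _ hf.2.2)
  rw [slotLaw_secondary_share_joint, slotLaw_secondary_share_alone] at h3
  refine h3.congr fun n => ?_
  rw [← add_div, ← Finset.sum_add_distrib]
  congr 1
  refine Finset.sum_congr rfl fun k _ => ?_
  change _ = ind (G.SecondaryDelivery q₀ i k ω)
  rw [← ind_and, ← ind_and, ← ind_or (fun h => by omega)]
  congr 1
  refine propext ?_
  unfold SecondaryDelivery PUIdle SecondarySuccess allocation
  rcases G.queue q₀ ω k with ⟨_ | q1, _ | q2⟩ <;> simp

omit h in
/-- A limit of probabilities agrees with the almost sure limit of the frequencies. -/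
lemma eq_of_tendsto_law_of_frequency {p : ℕ × ℕ → Prop} {ℓ c : ℝ}
    (hℓ : Tendsto (fun n => (G.law lam).real {ω | p (G.queue q₀ ω n)}) atTop (𝓝 ℓ))
    (hc : ∀ᵐ ω ∂G.law lam, Tendsto (fun n : ℕ => (∑ k ∈ Finset.range n,
      ind (p (G.queue q₀ ω k))) / n) atTop (𝓝 c)) : ℓ = c := by
  have hm : ∀ k, MeasurableSet {ω | p (G.queue q₀ ω k)} := fun k =>
    G.measurableSet_queue q₀ k {q | p q}
  have h1 := tendsto_integral_of_dominated_convergence (μ := G.law lam)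
    (F := fun n ω => (∑ k ∈ Finset.range n, ind (p (G.queue q₀ ω k))) / n) (f := fun _ => c)
    (fun _ => 1)
    (fun n => ((Finset.measurable_fun_sum _ fun k _ =>
      measurable_ind (hm k)).div_const _).aestronglyMeasurable)
    (integrable_const _) (fun n => Eventually.of_forall fun ω => ?_) hc
  · have h2 : ∀ n : ℕ, ∫ ω, (∑ k ∈ Finset.range n, ind (p (G.queue q₀ ω k))) / n ∂G.law lam =
        (n : ℝ)⁻¹ * ∑ k ∈ Finset.range n, (G.law lam).real {ω | p (G.queue q₀ ω k)} := fun n => by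
      rw [integral_div, integral_finsetSum _ fun k _ => integrable_ind (hm k)]
      simp_rw [fun k => integral_ind (μ := G.law lam) (hm k)]
      ring
    simp_rw [h2] at h1
    -- The mean frequency is the Cesàro average of the probabilities, hence has the same limit.
    simpa using tendsto_nhds_unique hℓ.cesaro h1
  · have h0 : 0 ≤ ∑ k ∈ Finset.range n, ind (p (G.queue q₀ ω k)) :=
      Finset.sum_nonneg fun _ _ => ind_nonneg _
    rw [Real.norm_of_nonneg (by positivity)]
    refine div_le_one_of_le₀ ?_ n.cast_nonneg
    exact (Finset.sum_le_sum fun _ _ => ind_le_one _).trans_eq (by simp)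

lemma tendsto_law_no_hit :
    Tendsto (fun n => (G.law lam).real {ω | ∀ k ≤ n, G.queue q₀ ω k ≠ 0}) atTop (𝓝 0) := by
  obtain ⟨a, b, θ, K, r, ha, hb, hθ, hK, hr0, hr1, -, hhit⟩ := G.exists_exponential_tails h q₀
  refine squeeze_zero (fun _ => measureReal_nonneg) (fun n => ENNReal.toReal_le_of_le_ofReal
    (by positivity) (hhit n)) ?_
  simpa using (tendsto_pow_atTop_nhds_zero_of_lt_one hr0.le hr1).const_mul K

/-- Monotonicity of `Q` makes its sublevel sets lower sets, so their probabilities converge; the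
uniform tail bound passes to the limit and prevents loss of mass. -/
lemma queueStable_of_tail {Q : ℕ × ℕ → ℕ} (hQ : Monotone Q)
    (hw : ∀ a b : ℝ, 0 < a → 0 < b → ∃ c > 0, ∀ q, c * Q q ≤ weight a b q) :
    QueueStable (G.law lam) fun n ω => Q (G.queue q₀ ω n) := by
  have hlim : ∀ x, ∃ ℓ, Tendsto (fun n => (G.law lam).real {ω | Q (G.queue q₀ ω n) < x}) atTop
      (𝓝 ℓ) := fun x =>
    G.exists_tendsto_law_queue lam (G.tendsto_law_no_hit q₀ h) (D := {q | Q q < x})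
      fun q q' hqq hq => (hQ hqq).trans_lt hq
  choose F hF using hlim
  refine ⟨F, hF, ?_⟩
  obtain ⟨a, b, θ, K, r, ha, hb, hθ, hK, -, -, htail, -⟩ := G.exists_exponential_tails h q₀
  obtain ⟨c, hc, hcw⟩ := hw a b ha hb
  have hlow : ∀ x : ℕ, 1 - K * Real.exp (-(θ * c)) ^ x ≤ F x := fun x => by
    refine ge_of_tendsto' (hF x) fun n => ?_
    have hm : MeasurableSet {ω | Q (G.queue q₀ ω n) < x} :=
      G.measurableSet_queue q₀ n {q | Q q < x}
    have h1 := probReal_compl_eq_one_sub (μ := G.law lam) hm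
    have h2 : (G.law lam).real {ω | Q (G.queue q₀ ω n) < x}ᶜ ≤
        K * Real.exp (-(θ * (c * x))) := by
      refine ENNReal.toReal_le_of_le_ofReal (by positivity)
        ((measure_mono fun ω hω => ?_).trans (htail n (c * x)))
      have h3 : (x : ℝ) ≤ Q (G.queue q₀ ω n) := by
        exact_mod_cast not_lt.1 (show ¬ Q (G.queue q₀ ω n) < x from hω)
      exact (mul_le_mul_of_nonneg_left h3 hc.le).trans (hcw _)
    have h4 : Real.exp (-(θ * c)) ^ x = Real.exp (-(θ * (c * x))) := by
      rw [← Real.exp_nat_mul]; ring_nf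
    rw [h4]
    linarith
  have hup : ∀ x, F x ≤ 1 := fun x => le_of_tendsto' (hF x) fun n => measureReal_le_one
  refine tendsto_of_tendsto_of_tendsto_of_le_of_le ?_ tendsto_const_nhds hlow hup
  have h5 : Real.exp (-(θ * c)) < 1 := by
    rw [Real.exp_lt_one_iff]; have := mul_pos hθ hc; linarith
  simpa using ((tendsto_pow_atTop_nhds_zero_of_lt_one (Real.exp_pos _).le h5).const_mul
    K).const_sub 1

theorem systemStable : G.SystemStable lam q₀ := by
  refine ⟨G.queueStable_of_tail q₀ h (Q := Prod.fst) monotone_fst fun a b ha hb =>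
    ⟨a, ha, fun q => ?_⟩, G.queueStable_of_tail q₀ h (Q := Prod.snd) monotone_snd fun a b ha hb =>
    ⟨b, hb, fun q => ?_⟩⟩
  · have : 0 ≤ b * q.2 := by positivity
    unfold weight; linarith
  · have : 0 ≤ a * q.1 := by positivity
    unfold weight; linarith

/-- Limits of the probabilities that the PU is idle with the relay queue nonempty or empty. -/
lemma tendsto_law_idle :
    Tendsto (fun n => (G.law lam).real {ω | (G.queue q₀ ω n).1 = 0 ∧ 0 < (G.queue q₀ ω n).2}) atTop
      (𝓝 (lam / G.μp * G.relayArrivalProb / G.fr)) ∧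
    Tendsto (fun n => (G.law lam).real {ω | (G.queue q₀ ω n).1 = 0 ∧ (G.queue q₀ ω n).2 = 0}) atTop
      (𝓝 (1 - lam / G.μp - lam / G.μp * G.relayArrivalProb / G.fr)) := by
  have hf := G.ae_frequencies q₀ h
  have hhit := G.tendsto_law_no_hit q₀ h
  obtain ⟨ℓ₁, h1⟩ := G.exists_tendsto_law_queue lam hhit (D := {q | q.1 = 0})
    fun q q' hqq hq => Nat.le_zero.1 (hqq.1.trans_eq hq)
  obtain ⟨ℓ₂, h2⟩ := G.exists_tendsto_law_queue lam hhit (D := {q | q.1 = 0 ∧ q.2 = 0})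
    fun q q' hqq hq => ⟨Nat.le_zero.1 (hqq.1.trans_eq hq.1), Nat.le_zero.1 (hqq.2.trans_eq hq.2)⟩
  -- This event is not a lower set, but it is the difference of two nested ones.
  have h3 : Tendsto (fun n => (G.law lam).real
      {ω | (G.queue q₀ ω n).1 = 0 ∧ 0 < (G.queue q₀ ω n).2}) atTop (𝓝 (ℓ₁ - ℓ₂)) := by
    refine (h1.sub h2).congr fun n => ?_
    rw [← measureReal_sdiff (fun ω hω => hω.1) (G.measurableSet_queue q₀ n _)]
    congr 1
    ext ω
    simp only [Set.mem_sdiff, Set.mem_ofPred_eq, not_and, Nat.pos_iff_ne_zero]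
    tauto
  have e2 := G.eq_of_tendsto_law_of_frequency q₀ (p := fun q => q.1 = 0 ∧ q.2 = 0) h2
    (hf.mono fun ω hω => hω.2.2)
  have e3 := G.eq_of_tendsto_law_of_frequency q₀ (p := fun q => q.1 = 0 ∧ 0 < q.2) h3
    (hf.mono fun ω hω => hω.2.1)
  exact ⟨e3 ▸ h3, e2 ▸ h2⟩

end Rates

/-! ### Conditional success probability of the secondary link -/

section Conditional

variable (q₀ : ℕ × ℕ) {lam : unitInterval}

/-- A queue event at the beginning of a slot is independent of the randomness of that slot. -/
lemma law_queue_and_slot (n : ℕ) (p : ℕ × ℕ → Prop) {B : Slot G.N → Prop}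
    (hB : MeasurableSet {x | B x}) :
    (G.law lam).real {ω | p (G.queue q₀ ω n) ∧ B (ω n)} =
      (G.law lam).real {ω | p (G.queue q₀ ω n)} * (G.slotLaw lam).real {x | B x} :=
  measureReal_past (G.slotLaw lam) (G.measurable_past_queue q₀ n) (A := {q | p q}) (.of_discrete) hB

lemma law_idle_and_success (n : ℕ) :
    (G.law lam).real ({ω | G.PUIdle q₀ n ω} ∩ {ω | G.SecondarySuccess q₀ n ω}) =
      (G.law lam).real {ω | (G.queue q₀ ω n).1 = 0 ∧ 0 < (G.queue q₀ ω n).2} * G.fsBusy +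
      (G.law lam).real {ω | (G.queue q₀ ω n).1 = 0 ∧ (G.queue q₀ ω n).2 = 0} * G.fsEmpty := by
  have hJ := G.measurableSet_secondaryOK G.measurable_jointAllocation.1
    G.measurable_jointAllocation.2.2.1
  have hE := G.measurableSet_secondaryOK G.measurable_aloneAllocation_s
    G.measurable_aloneAllocation_Ps
  rw [← G.slotLaw_secondaryOK_joint lam, ← G.slotLaw_secondaryOK_alone lam,
    ← G.law_queue_and_slot q₀ n (fun q => q.1 = 0 ∧ 0 < q.2) hJ,
    ← G.law_queue_and_slot q₀ n (fun q => q.1 = 0 ∧ q.2 = 0) hE, ← measureReal_union]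
  · congr 1
    ext ω
    simp only [Set.mem_inter_iff, Set.mem_union, Set.mem_ofPred_eq, PUIdle, SecondarySuccess,
      allocation]
    rcases G.queue q₀ ω n with ⟨_ | q1, _ | q2⟩ <;> simp
  · exact Set.disjoint_left.2 fun ω h1 h2 => h1.1.2.ne' h2.1.2
  · exact (G.measurableSet_queue q₀ n {q | q.1 = 0 ∧ q.2 = 0}).inter
      (hE.preimage (measurable_pi_apply n))

variable (h : (lam : ℝ) * (G.fr + G.relayArrivalProb) < G.fr * G.μp)

include h

lemma lam_lt_μp : (lam : ℝ) < G.μp := by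
  have h1 : 0 ≤ (lam : ℝ) * G.relayArrivalProb := mul_nonneg lam.2.1 G.relayArrivalProb_nonneg
  have h2 : G.fr * lam < G.fr * G.μp := by linarith
  exact lt_of_mul_lt_mul_left h2 G.fr_pos.le

/-- Identifies γ as the share of idle slots with nonempty relay queue, which links the conditional
success probability to the throughput. -/
lemma γ_mul_idle : G.γ lam * (1 - lam / G.μp) = lam / G.μp * G.relayArrivalProb / G.fr := by
  have h1 := G.fr_pos.ne'
  have h2 := G.μp_pos.ne'
  have h3 : G.μp - lam ≠ 0 := (sub_pos.2 (G.lam_lt_μp h)).ne'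
  unfold γ relayArrivalProb
  field_simp

/-- For each n the conditional probability is a quotient of combinations of two state probabilities,
both of which converge; the denominator tends to 1 - lam / μp > 0. -/
lemma isSecondarySuccessProb : G.IsSecondarySuccessProb lam q₀
    (G.γ lam * G.fsBusy + (1 - G.γ lam) * G.fsEmpty) := by
  obtain ⟨h1, h2⟩ := G.tendsto_law_idle q₀ h
  have hidle : ∀ n, (G.law lam).real {ω | G.PUIdle q₀ n ω} =
      (G.law lam).real {ω | (G.queue q₀ ω n).1 = 0 ∧ 0 < (G.queue q₀ ω n).2} +
      (G.law lam).real {ω | (G.queue q₀ ω n).1 = 0 ∧ (G.queue q₀ ω n).2 = 0} := fun n => by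
    have hm : MeasurableSet {ω | (G.queue q₀ ω n).1 = 0 ∧ (G.queue q₀ ω n).2 = 0} :=
      G.measurableSet_queue q₀ n {q | q.1 = 0 ∧ q.2 = 0}
    rw [← measureReal_union (Set.disjoint_left.2 fun ω a b => a.2.ne' b.2) hm]
    congr 1
    ext ω
    simp only [Set.mem_union, Set.mem_ofPred_eq, PUIdle]
    omega
  have hpos : 0 < 1 - lam / G.μp :=
    sub_pos.2 ((div_lt_one G.μp_pos).2 (G.lam_lt_μp h))
  have h3 := ((h1.mul_const G.fsBusy).add (h2.mul_const G.fsEmpty)).div (h1.add h2)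
    (by rw [add_sub_cancel]; exact hpos.ne')
  unfold IsSecondarySuccessProb
  have e : (lam / G.μp * G.relayArrivalProb / G.fr * G.fsBusy +
      (1 - lam / G.μp - lam / G.μp * G.relayArrivalProb / G.fr) * G.fsEmpty) /
      (lam / G.μp * G.relayArrivalProb / G.fr +
        (1 - lam / G.μp - lam / G.μp * G.relayArrivalProb / G.fr)) =
      G.γ lam * G.fsBusy + (1 - G.γ lam) * G.fsEmpty := by
    rw [add_sub_cancel, div_eq_iff hpos.ne', ← G.γ_mul_idle h]
    ring
  rw [e] at h3
  refine h3.congr fun n => ?_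
  have hm : MeasurableSet {ω | G.PUIdle q₀ n ω} := G.measurableSet_queue q₀ n {q | q.1 = 0}
  rw [measureReal_def (G.law lam)[|_], cond_apply hm, ENNReal.toReal_mul, ENNReal.toReal_inv,
    ← measureReal_def, ← measureReal_def, G.law_idle_and_success, hidle, mul_comm, ← div_eq_mul_inv]
  rfl

lemma secondaryThroughput (i : Fin G.N) : G.SecondaryThroughput lam q₀ i
    (1 / (G.N : ℝ) * (1 - (lam : ℝ) / (G.fp + (1 - G.fp) * G.fps)) *
      (G.γ lam * G.fsBusy + (1 - G.γ lam) * G.fsEmpty)) := by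
  have h1 := G.secondaryThroughput_eq q₀ h i
  convert h1 using 1
  change 1 / (G.N : ℝ) * (1 - (lam : ℝ) / G.μp) * _ = _
  rw [← G.γ_mul_idle h]
  ring

end Conditional

/-! ### Necessity of the stability condition -/

section Instability

variable (q₀ : ℕ × ℕ) (lam : unitInterval)

lemma integral_increment_queue (a b : ℝ) (n : ℕ) :
    ∫ ω, G.increment a b (G.queue q₀ ω n) (ω n) ∂G.law lam =
      a * (lam - (G.law lam).real {ω | 0 < (G.queue q₀ ω n).1} * G.μp) +
      b * ((G.law lam).real {ω | 0 < (G.queue q₀ ω n).1} * G.relayArrivalProb -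
        (G.law lam).real {ω | (G.queue q₀ ω n).1 = 0 ∧ 0 < (G.queue q₀ ω n).2} * G.fr) := by
  have hev := measurable_pi_apply (X := fun _ : ℕ => Slot G.N) n
  have key : ∀ (p : ℕ × ℕ → Prop) {B : Slot G.N → Prop}, MeasurableSet {x | B x} →
      Integrable (fun ω => ind (p (G.queue q₀ ω n)) * ind (B (ω n))) (G.law lam) ∧
      ∫ ω, ind (p (G.queue q₀ ω n)) * ind (B (ω n)) ∂G.law lam =
        (G.law lam).real {ω | p (G.queue q₀ ω n)} * (G.slotLaw lam).real {x | B x} := by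
    intro p B hB
    have hm : MeasurableSet {ω : ℕ → Slot G.N | p (G.queue q₀ ω n) ∧ B (ω n)} :=
      (G.measurableSet_queue q₀ n {q | p q}).inter (hB.preimage hev)
    simp_rw [← ind_and]
    exact ⟨integrable_ind hm, by rw [integral_ind hm, G.law_queue_and_slot q₀ n p hB]⟩
  obtain ⟨iA, eA⟩ := key (fun _ => True) G.measurableSet_arrival
  obtain ⟨iL, eL⟩ := key (fun q => 0 < q.1) G.measurableSet_leaves
  obtain ⟨iO, eO⟩ := key (fun q => 0 < q.1) G.measurableSet_overheard_not_direct
  obtain ⟨iR, eR⟩ := key (fun q => q.1 = 0 ∧ 0 < q.2) G.measurableSet_relayOK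
  simp only [ind_of_true, one_mul] at iA eA
  rw [slotLaw_arrival] at eA
  rw [slotLaw_leaves] at eL
  rw [slotLaw_overheard_not_direct] at eO
  rw [slotLaw_relayOK] at eR
  have e := integral_add ((iA.sub iL).const_mul a) ((iO.sub iR).const_mul b)
  simp only [Pi.sub_apply] at e
  rw [integral_const_mul, integral_const_mul, integral_sub iA iL, integral_sub iO iR, eA, eL, eO,
    eR] at e
  refine Eq.trans e ?_
  have hu : (G.law lam).real {_ω : ℕ → Slot G.N | True} = 1 := probReal_univ
  rw [hu, relayArrivalProb]
  ring

lemma weight_queue_eq_sum (a b : ℝ) (ω : ℕ → Slot G.N) (n : ℕ) :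
    weight a b (G.queue q₀ ω n) =
      weight a b q₀ + ∑ k ∈ Finset.range n, G.increment a b (G.queue q₀ ω k) (ω k) := by
  induction n with
  | zero => simp [queue]
  | succ n ih => rw [Finset.sum_range_succ, queue, weight_step, ih]; ring

lemma weight_queue_le {a b : ℝ} (ha : 0 ≤ a) (hb : 0 ≤ b) (ω : ℕ → Slot G.N) (n : ℕ) :
    weight a b (G.queue q₀ ω n) ≤ weight a b q₀ + n * (a + b) := by
  rw [weight_queue_eq_sum]
  gcongr
  refine (Finset.sum_le_sum fun k _ => (le_abs_self _).trans
    (abs_increment_le ha hb _ _)).trans_eq ?_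
  rw [Finset.sum_const, Finset.card_range, nsmul_eq_mul]

lemma integrable_weight_queue {a b : ℝ} (ha : 0 ≤ a) (hb : 0 ≤ b) (n : ℕ) :
    Integrable (fun ω => weight a b (G.queue q₀ ω n)) (G.law lam) :=
  Integrable.of_bound (((Measurable.of_discrete (f := weight a b)).comp
    (G.measurable_queue q₀ n)).aestronglyMeasurable) (weight a b q₀ + n * (a + b))
    (Eventually.of_forall fun ω => by
      rw [Real.norm_of_nonneg (weight_nonneg ha hb _)]
      exact G.weight_queue_le q₀ ha hb ω n)

lemma integrable_increment_queue {a b : ℝ} (ha : 0 ≤ a) (hb : 0 ≤ b) (n : ℕ) :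
    Integrable (fun ω => G.increment a b (G.queue q₀ ω n) (ω n)) (G.law lam) := by
  refine ((G.integrable_weight_queue q₀ lam ha hb (n + 1)).sub
    (G.integrable_weight_queue q₀ lam ha hb n)).congr (Eventually.of_forall fun ω => ?_)
  simp [queue, weight_step]

/-- At and above the critical load a linear function of the queue lengths grows in the mean, in
proportion to the time spent in the empty state. -/
lemma weight_add_sum_le_integral
    (h : G.fr * G.μp ≤ (lam : ℝ) * (G.fr + G.relayArrivalProb)) (n : ℕ) :
    weight G.fr lam q₀ +
      G.fr * lam * ∑ k ∈ Finset.range n, (G.law lam).real {ω | G.queue q₀ ω k = 0} ≤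
      ∫ ω, weight G.fr lam (G.queue q₀ ω n) ∂G.law lam := by
  have hfr := G.fr_pos.le
  have hl := lam.2.1
  simp_rw [fun ω => G.weight_queue_eq_sum q₀ G.fr lam ω n]
  rw [integral_add (integrable_const _)
    (integrable_finsetSum _ fun k _ => G.integrable_increment_queue q₀ lam hfr hl k),
    integral_finsetSum _ fun k _ => G.integrable_increment_queue q₀ lam hfr hl k, Finset.mul_sum]
  simp only [integral_const, probReal_univ, smul_eq_mul, one_mul]
  gcongr with k _
  rw [integral_increment_queue]
  -- Busy, idle with packets to relay, and empty are the three types of state. With the weights fr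
  -- and lam their drifts are nonnegative, 0 and fr lam.
  have hsum : (G.law lam).real {ω | 0 < (G.queue q₀ ω k).1} +
      (G.law lam).real {ω | (G.queue q₀ ω k).1 = 0 ∧ 0 < (G.queue q₀ ω k).2} +
      (G.law lam).real {ω | G.queue q₀ ω k = 0} = 1 := by
    have m₁ : MeasurableSet {ω | (G.queue q₀ ω k).1 = 0 ∧ 0 < (G.queue q₀ ω k).2} :=
      G.measurableSet_queue q₀ k {q | q.1 = 0 ∧ 0 < q.2}
    have m₂ : MeasurableSet {ω | G.queue q₀ ω k = 0} := G.measurableSet_queue q₀ k {0}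
    rw [← measureReal_union ?_ m₁, ← measureReal_union ?_ m₂, ← probReal_univ (μ := G.law lam)]
    · congr 1
      ext ω
      simp only [Set.mem_union, Set.mem_ofPred_eq, Set.mem_univ, iff_true, Prod.ext_iff,
        Prod.fst_zero, Prod.snd_zero]
      omega
    · refine Set.disjoint_left.2 fun ω h1 h2 => ?_
      simp only [Set.mem_union, Set.mem_ofPred_eq, Prod.ext_iff, Prod.fst_zero,
        Prod.snd_zero] at h1 h2
      omega
    · exact Set.disjoint_left.2 fun ω h1 h2 => h1.ne' h2.1
  have hb : 0 ≤ (G.law lam).real {ω | 0 < (G.queue q₀ ω k).1} := measureReal_nonneg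
  have h1 : 0 ≤ (G.law lam).real {ω | 0 < (G.queue q₀ ω k).1} *
      ((lam : ℝ) * (G.fr + G.relayArrivalProb) - G.fr * G.μp) := mul_nonneg hb (sub_nonneg.2 h)
  linear_combination h1 + G.fr * lam * hsum

/-- Short queues empty with a probability that is bounded below. -/
lemma pow_mul_law_le (n s : ℕ) :
    (G.slotLaw lam).real {x | x.arrival = false ∧ G.DirectOK x ∧
      G.RelayOK (G.jointAllocation x) x} ^ s *
      (G.law lam).real {ω | (G.queue q₀ ω n).1 + (G.queue q₀ ω n).2 ≤ s} ≤
      (G.law lam).real {ω | G.queue q₀ ω (n + s) = 0} := by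
  have hserve : MeasurableSet {x : Slot G.N | x.arrival = false ∧ G.DirectOK x ∧
      G.RelayOK (G.jointAllocation x) x} :=
    (Slot.measurable_arrival (measurableSet_singleton false)).inter
      (G.measurableSet_directOK.inter G.measurableSet_relayOK)
  induction s generalizing n with
  | zero =>
    rw [pow_zero, one_mul]
    refine measureReal_mono fun ω hω => ?_
    simp only [Set.mem_ofPred_eq, Prod.ext_iff, Prod.fst_zero, Prod.snd_zero, add_zero] at hω ⊢
    omega
  | succ s ih =>
    have h1 := G.law_queue_and_slot q₀ (lam := lam) n (fun q => q.1 + q.2 ≤ s + 1) hserve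
    have h2 : (G.law lam).real {ω | (G.queue q₀ ω n).1 + (G.queue q₀ ω n).2 ≤ s + 1 ∧
        ((ω n).arrival = false ∧ G.DirectOK (ω n) ∧
          G.RelayOK (G.jointAllocation (ω n)) (ω n))} ≤
        (G.law lam).real {ω | (G.queue q₀ ω (n + 1)).1 + (G.queue q₀ ω (n + 1)).2 ≤ s} := by
      refine measureReal_mono fun ω hω => ?_
      obtain ⟨hs, hA, hD, hR⟩ := hω
      change (G.step (ω n) (G.queue q₀ ω n)).1 + (G.step (ω n) (G.queue q₀ ω n)).2 ≤ s
      revert hs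
      -- Without an arrival and with both links working, one packet leaves the system from any
      -- nonempty state: success of the direct link also rules out a transfer to the relay queue.
      rcases G.queue q₀ ω n with ⟨_ | q1, _ | q2⟩ <;> intro hs <;>
        simp [step, allocation, hA, hD, hR] at hs ⊢ <;> omega
    have h3 := ih (n + 1)
    rw [show n + 1 + s = n + (s + 1) by ring] at h3
    refine le_trans ?_ h3
    rw [pow_succ, mul_assoc]
    refine mul_le_mul_of_nonneg_left ?_ (pow_nonneg measureReal_nonneg _)
    rw [mul_comm, ← h1]
    exact h2

variable {q₀ lam}

/-- A finite limit law puts mass close to 1 below some level; a union bound combines the two queues,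
so no joint convergence is needed. -/
lemma exists_tight (h : G.SystemStable lam q₀) {ε : ℝ} (hε : 0 < ε) :
    ∃ x : ℕ, ∀ᶠ n in atTop,
      1 - ε < (G.law lam).real {ω | (G.queue q₀ ω n).1 < x ∧ (G.queue q₀ ω n).2 < x} := by
  obtain ⟨⟨F₁, hF₁, h₁⟩, ⟨F₂, hF₂, h₂⟩⟩ := h
  have he : 1 - ε / 2 < 1 := by linarith
  obtain ⟨x, hx₁, hx₂⟩ := ((h₁.eventually (lt_mem_nhds he)).and
    (h₂.eventually (lt_mem_nhds he))).exists
  refine ⟨x, ?_⟩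
  filter_upwards [(hF₁ x).eventually (lt_mem_nhds hx₁), (hF₂ x).eventually (lt_mem_nhds hx₂)]
    with n hn₁ hn₂
  have m₁ : MeasurableSet {ω | (G.queue q₀ ω n).1 < x} := G.measurableSet_queue q₀ n {q | q.1 < x}
  have m₂ : MeasurableSet {ω | (G.queue q₀ ω n).2 < x} := G.measurableSet_queue q₀ n {q | q.2 < x}
  have h3 := measureReal_union_add_inter (μ := G.law lam) (s := {ω | (G.queue q₀ ω n).1 < x}) m₂
  have h4 : (G.law lam).real ({ω | (G.queue q₀ ω n).1 < x} ∪ {ω | (G.queue q₀ ω n).2 < x}) ≤ 1 :=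
    measureReal_le_one
  have h5 : {ω | (G.queue q₀ ω n).1 < x ∧ (G.queue q₀ ω n).2 < x} =
    {ω | (G.queue q₀ ω n).1 < x} ∩ {ω | (G.queue q₀ ω n).2 < x} := rfl
  rw [h5]
  linarith

/-- A stable system is empty with a probability that is bounded below. -/
lemma exists_le_law_empty (hlam : lam < 1) (h : G.SystemStable lam q₀) :
    ∃ c > 0, ∃ n₀, ∀ n ≥ n₀, c ≤ (G.law lam).real {ω | G.queue q₀ ω n = 0} := by
  obtain ⟨x, hx⟩ := G.exists_tight h (ε := 1 / 2) (by norm_num)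
  obtain ⟨m, hm⟩ := eventually_atTop.1 hx
  have hp := G.slotLaw_serve_pos lam hlam
  set p := (G.slotLaw lam).real {x | x.arrival = false ∧ G.DirectOK x ∧
      G.RelayOK (G.jointAllocation x) x} with hpdef
  -- With probability above 1/2 both queues are shorter than x at time n - 2x; then 2x successive
  -- favourable slots suffice to empty the system.
  refine ⟨p ^ (2 * x) * (1 / 2), by positivity, m + 2 * x, fun n hn => ?_⟩
  have h1 := G.pow_mul_law_le q₀ lam (n - 2 * x) (2 * x)
  rw [Nat.sub_add_cancel (by omega)] at h1
  refine le_trans ?_ h1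
  rw [← hpdef]
  refine mul_le_mul_of_nonneg_left ?_ (by positivity)
  have h2 := hm (n - 2 * x) (by omega)
  have h3 : (G.law lam).real {ω | (G.queue q₀ ω (n - 2 * x)).1 < x ∧
      (G.queue q₀ ω (n - 2 * x)).2 < x} ≤ (G.law lam).real
      {ω | (G.queue q₀ ω (n - 2 * x)).1 + (G.queue q₀ ω (n - 2 * x)).2 ≤ 2 * x} := by
    refine measureReal_mono fun ω hω => ?_
    obtain ⟨a, b⟩ := hω
    change (G.queue q₀ ω (n - 2 * x)).1 + (G.queue q₀ ω (n - 2 * x)).2 ≤ 2 * x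
    omega
  linarith

/-- In a stable system the mean queue lengths grow sublinearly. -/
lemma exists_integral_weight_le (h : G.SystemStable lam q₀) {a b : ℝ} (ha : 0 ≤ a) (hb : 0 ≤ b)
    {ε : ℝ} (hε : 0 < ε) : ∃ C : ℝ, ∀ᶠ n : ℕ in atTop,
      ∫ ω, weight a b (G.queue q₀ ω n) ∂G.law lam ≤ C + ε * (a + b) * n := by
  obtain ⟨x, hx⟩ := G.exists_tight h hε
  refine ⟨weight a b (x, x) + ε * weight a b q₀, ?_⟩
  filter_upwards [hx] with n hn
  have hm : MeasurableSet {ω | (G.queue q₀ ω n).1 < x ∧ (G.queue q₀ ω n).2 < x} :=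
    G.measurableSet_queue q₀ n {q | q.1 < x ∧ q.2 < x}
  set T := {ω | (G.queue q₀ ω n).1 < x ∧ (G.queue q₀ ω n).2 < x}
  have hT : (G.law lam).real {ω | ω ∉ T} ≤ ε := by
    have := probReal_compl_eq_one_sub (μ := G.law lam) hm
    change (G.law lam).real Tᶜ ≤ ε
    linarith
  have hq : 0 ≤ weight a b q₀ := weight_nonneg ha hb _
  -- Outside the tight event T, of probability at most ε, the weight is bounded by its deterministic
  -- linear growth.
  have hbound : ∀ ω, weight a b (G.queue q₀ ω n) ≤
      weight a b (x, x) + (weight a b q₀ + n * (a + b)) * ind (ω ∉ T) := fun ω => by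
    by_cases hω : ω ∈ T
    · rw [ind_of_false (not_not.2 hω), mul_zero, add_zero]
      have h1 : ((G.queue q₀ ω n).1 : ℝ) ≤ x := by exact_mod_cast hω.1.le
      have h2 : ((G.queue q₀ ω n).2 : ℝ) ≤ x := by exact_mod_cast hω.2.le
      unfold weight
      gcongr
    · rw [ind_of_true hω, mul_one]
      have := G.weight_queue_le q₀ ha hb ω n
      have h2 := weight_nonneg ha hb (x, x)
      linarith
  have hi := (integrable_ind (μ := G.law lam) (p := fun ω => ω ∉ T) hm.compl).const_mul
    (weight a b q₀ + n * (a + b))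
  have h1 := integral_mono (G.integrable_weight_queue q₀ lam ha hb n)
    ((integrable_const (weight a b (x, x))).add hi) hbound
  simp only [Pi.add_apply] at h1
  rw [integral_add (integrable_const _) hi, integral_const_mul,
    integral_ind (p := fun ω => ω ∉ T) hm.compl] at h1
  simp only [integral_const, probReal_univ, smul_eq_mul, one_mul] at h1
  have h2 : (weight a b q₀ + n * (a + b)) * (G.law lam).real {ω | ω ∉ T} ≤
      (weight a b q₀ + n * (a + b)) * ε := by gcongr
  linarith

/-- Otherwise the mean of one and the same weight would grow at least like d n, by the time spent
empty, and at most like (d / 2) n, by tightness, up to constants. -/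
theorem lt_of_systemStable (hlam : lam < 1) (h : G.SystemStable lam q₀) :
    (lam : ℝ) * (G.fr + G.relayArrivalProb) < G.fr * G.μp := by
  by_contra hle
  rw [not_lt] at hle
  have hfr := G.fr_pos
  have hl0 : 0 < (lam : ℝ) := by
    have h1 := (mul_pos hfr G.μp_pos).trans_le hle
    exact pos_of_mul_pos_left h1 (add_nonneg hfr.le G.relayArrivalProb_nonneg)
  obtain ⟨c, hc, n₀, hn₀⟩ := G.exists_le_law_empty hlam h
  have hsum : ∀ n : ℕ, c * (n - n₀) ≤
      ∑ k ∈ Finset.range n, (G.law lam).real {ω | G.queue q₀ ω k = 0} := fun n => by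
    induction n with
    | zero =>
      simp only [Nat.cast_zero, zero_sub, Finset.range_zero, Finset.sum_empty]
      have : 0 ≤ c * n₀ := by positivity
      linarith
    | succ n ih =>
      rw [Finset.sum_range_succ]
      push_cast
      by_cases hn : n₀ ≤ n
      · have := hn₀ n hn
        linarith
      · have h1 : ((n : ℝ) + 1) - n₀ ≤ 0 := by
          have : (n : ℝ) + 1 ≤ n₀ := by exact_mod_cast not_le.1 hn
          linarith
        have h2 : c * ((n : ℝ) + 1 - n₀) ≤ 0 := mul_nonpos_of_nonneg_of_nonpos hc.le h1
        exact h2.trans (add_nonneg (Finset.sum_nonneg fun _ _ => measureReal_nonneg)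
          measureReal_nonneg)
  set d := G.fr * lam * c with hd
  have hd0 : 0 < d := by positivity
  -- This ε makes the slope of the upper bound d / 2, half of that of the lower bound.
  obtain ⟨C, hC⟩ := G.exists_integral_weight_le h hfr.le hl0.le
    (ε := d / (2 * (G.fr + lam))) (by positivity)
  have hεd : d / (2 * (G.fr + lam)) * (G.fr + lam) = d / 2 := by
    field_simp
  rw [hεd] at hC
  obtain ⟨n, hn, hn1⟩ := (hC.and (tendsto_natCast_atTop_atTop.eventually
    (eventually_gt_atTop ((C + d * n₀) / (d / 2))))).exists
  rw [div_lt_iff₀ (by positivity)] at hn1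
  have h1 := G.weight_add_sum_le_integral q₀ lam hle n
  have h2 : G.fr * lam * (c * (n - n₀)) ≤ G.fr * lam *
      ∑ k ∈ Finset.range n, (G.law lam).real {ω | G.queue q₀ ω k = 0} := by
    gcongr
    exact hsum n
  have h3 : 0 ≤ weight G.fr lam q₀ := weight_nonneg hfr.le hl0.le _
  have h4 : G.fr * lam * (c * (n - n₀)) = d * n - d * n₀ := by rw [hd]; ring
  linarith

end Instability

/-! ### Stability threshold and maximum PU throughput -/

section MaximumThroughput

variable (q₀ : ℕ × ℕ)

lemma lt_maxThroughput_iff (lam : ℝ) :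
    lam < G.fr * (G.fp + (1 - G.fp) * G.fps) / (G.fr + (1 - G.fp) * G.fps) ↔
      lam * (G.fr + G.relayArrivalProb) < G.fr * G.μp :=
  lt_div_iff₀ (add_pos_of_pos_of_nonneg G.fr_pos G.relayArrivalProb_nonneg)

lemma systemStable_iff {lam : unitInterval} (hlam : lam < 1) :
    G.SystemStable lam q₀ ↔
      (lam : ℝ) < G.fr * (G.fp + (1 - G.fp) * G.fps) / (G.fr + (1 - G.fp) * G.fps) := by
  rw [lt_maxThroughput_iff]
  exact ⟨G.lt_of_systemStable hlam, G.systemStable q₀⟩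

lemma primaryThroughput_unique {lam : unitInterval} {τ τ' : ℝ}
    (h : G.PrimaryThroughput lam q₀ τ) (h' : G.PrimaryThroughput lam q₀ τ') : τ = τ' := by
  obtain ⟨ω, h1, h2⟩ := (h.and h').exists
  exact tendsto_nhds_unique h1 h2

lemma maxThroughput_le_one :
    G.fr * (G.fp + (1 - G.fp) * G.fps) / (G.fr + (1 - G.fp) * G.fps) ≤ 1 := by
  have h0 := G.fr_pos
  have h1 := G.relayArrivalProb_nonneg
  have h2 : G.μp ≤ 1 := by rw [← G.slotLaw_leaves 0]; exact measureReal_le_one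
  refine div_le_one_of_le₀ ?_ (add_nonneg h0.le h1)
  change G.fr * G.μp ≤ G.fr + G.relayArrivalProb
  nlinarith

/-- In the stable regime the throughput equals the arrival rate, so the supremum is that of the
stable rates. It is not attained, but every nonnegative t below the threshold is itself an
admissible rate, as the threshold is at most 1. -/
lemma isLUB_primaryThroughput :
    IsLUB {τ : ℝ | ∃ lam : unitInterval, lam < 1 ∧ G.SystemStable lam q₀ ∧
        G.PrimaryThroughput lam q₀ τ}
      (G.fr * (G.fp + (1 - G.fp) * G.fps) / (G.fr + (1 - G.fp) * G.fps)) := by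
  constructor
  · rintro τ ⟨lam, hlam, hs, hτ⟩
    have h1 := (G.systemStable_iff q₀ hlam).1 hs
    have h2 := G.primaryThroughput_eq q₀ ((G.lt_maxThroughput_iff lam).1 h1)
    rw [G.primaryThroughput_unique q₀ hτ h2]
    exact h1.le
  · intro u hu
    have key : ∀ t : ℝ, 0 ≤ t →
        t < G.fr * (G.fp + (1 - G.fp) * G.fps) / (G.fr + (1 - G.fp) * G.fps) → t ≤ u := by
      intro t ht0 ht
      have ht1 : t < 1 := ht.trans_le G.maxThroughput_le_one
      have hs := (G.lt_maxThroughput_iff t).1 ht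
      exact hu ⟨⟨t, ht0, ht1.le⟩, ht1, G.systemStable q₀ (lam := ⟨t, ht0, ht1.le⟩) hs,
        G.primaryThroughput_eq q₀ (lam := ⟨t, ht0, ht1.le⟩) hs⟩
    have h0 : 0 < G.fr * (G.fp + (1 - G.fp) * G.fps) / (G.fr + (1 - G.fp) * G.fps) := by
      rw [lt_maxThroughput_iff, zero_mul]
      exact mul_pos G.fr_pos G.μp_pos
    refine le_of_forall_lt_imp_le_of_dense fun t ht => ?_
    -- A negative t is not an arrival rate; it lies below the throughput 0, which is attained since
    -- the threshold is positive.
    rcases le_total 0 t with h | h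
    · exact key t h ht
    · exact h.trans (key 0 le_rfl h0)

end MaximumThroughput

end Network

end CognitiveRelay

end

theorem theorem1 (G : CognitiveRelay.Network) (q₀ : ℕ × ℕ) :
    -- stability
    (∀ lam : unitInterval, lam < 1 →
      (G.SystemStable lam q₀ ↔
        (lam : ℝ) < G.fr * (G.fp + (1 - G.fp) * G.fps) / (G.fr + (1 - G.fp) * G.fps))) ∧
    -- maximum achievable throughput of the primary user
    IsLUB {τ : ℝ | ∃ lam : unitInterval, lam < 1 ∧ G.SystemStable lam q₀ ∧
        G.PrimaryThroughput lam q₀ τ}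
      (G.fr * (G.fp + (1 - G.fp) * G.fps) / (G.fr + (1 - G.fp) * G.fps)) ∧
    -- throughput of the primary and of each secondary user in the stable regime
    (∀ lam : unitInterval, lam < 1 →
      (lam : ℝ) < G.fr * (G.fp + (1 - G.fp) * G.fps) / (G.fr + (1 - G.fp) * G.fps) →
      G.PrimaryThroughput lam q₀ lam ∧
      ∃ fs : ℝ, G.IsSecondarySuccessProb lam q₀ fs ∧
        fs = G.γ lam * G.fsBusy + (1 - G.γ lam) * G.fsEmpty ∧
        ∀ i : Fin G.N, G.SecondaryThroughput lam q₀ i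
          (1 / (G.N : ℝ) * (1 - (lam : ℝ) / (G.fp + (1 - G.fp) * G.fps)) * fs)) := by
  refine ⟨fun lam hlam => G.systemStable_iff q₀ hlam, G.isLUB_primaryThroughput q₀,
    fun lam _ hlt => ?_⟩
  have h := (G.lt_maxThroughput_iff lam).1 hlt
  exact ⟨G.primaryThroughput_eq q₀ h, _, G.isSecondarySuccessProb q₀ h, rfl,
    fun i => G.secondaryThroughput q₀ h i⟩
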